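/- **Theorem (multiple-fragment heuristic).** Let $d$ be a symmetric distance function on $n$ sites with values in a totally ordered set. The multiple-fragment TSP heuristic considers all edges between distinct sites one at a time, in nondecreasing order of length (ties in any order), and includes an edge if it connects endpoints of two different fragments; the fragments are the connected components (paths or single sites) of the graph of the edges included so far. Its tour consists of the included edges together with, when $n\ge 3$, the edge joining the two endpoints of the last fragment. 1. For every $d$, the possible sequences of included edges are exactly the possible sequences of edges added by bottom-up hierarchical clustering in which the clusters are the fragments, initially the single sites, the distance of two clusters is the length of a shortest edge connecting their endpoints, and each step merges a closest pair of clusters by adding such a shortest edge. They are also exactly the possible sequences of pairs selected by the following process, which maintains the set of fragment endpoints, initially all sites. Distances between endpoints of the same fragment are taken to be $+\infty$. While some two different endpoints have finite distance, select a closest pair of endpoints, delete those of the two that belong to a nontrivial fragment, and set the distance between the two endpoints of the combined fragment to $+\infty$. 2. The heuristic can be implemented in time $O(n^2)$: there is one program that, for all $n$ and $d$, outputs the included edges in order, for some order of the ties, followed by the closing edge if $n \ge 3$, in $O(n^2)$ steps. 3. The heuristic can also be implemented, in the same sense, in time $O(n^2\log^2 n)$ and space $O(n)$. Here programs run on a deterministic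 random access machine with words of $O(\log n)$ bits, unit-cost instructions (additions, subtractions, multiplications, divisions, memory accesses, tests) and a write-only output. The machine is given $n$, the sites are $0,\dots,n-1$, and a test whether $d(a,b)\le d(c,e)$ takes constant time. Space is the number of words of memory, and all bounds are uniform in $d$. -/

import Mathlib

open Filter Asymptotics

namespace MultipleFragment

/-! ### The multiple-fragment heuristic

The sites are the elements of `Fin n`. The distance is symmetric and takes values in an arbitrary
linear order, so it is a function `d : Sym2 (Fin n) → D` of the edge `s(i, j)`. -/

/-- The graph formed by the edges chosen so far; its connected components are the fragments. -/
def fragmentGraph {n : ℕ} (F : List (Sym2 (Fin n))) : SimpleGraph (Fin n) :=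
  SimpleGraph.fromEdgeSet {e | e ∈ F}

/-- The fragments are paths (possibly a single site), so a site is an endpoint of its fragment iff
it has at most one neighbor in the graph of chosen edges. -/
def IsEndpoint {n : ℕ} (F : List (Sym2 (Fin n))) (v : Fin n) : Prop :=
  ((fragmentGraph F).neighborSet v).Subsingleton

/-- The edge `e` connects endpoints of two different fragments. -/
def Joins {n : ℕ} (F : List (Sym2 (Fin n))) (e : Sym2 (Fin n)) : Prop :=
  ∃ u v : Fin n, e = s(u, v) ∧ IsEndpoint F u ∧ IsEndpoint F v ∧ ¬ (fragmentGraph F).Reachable u v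

open Classical in
/-- Consider the edges of `L` one at a time, and include an edge if it connects endpoints of two
fragments. The result lists the included edges in the order in which they are included. -/
noncomputable def scan {n : ℕ} (L : List (Sym2 (Fin n))) : List (Sym2 (Fin n)) :=
  L.foldl (fun F e => if Joins F e then F ++ [e] else F) []

/-- `F` is a sequence of edges included by the multiple-fragment heuristic: the result of scanning
all edges of the complete graph in some order of nondecreasing length (ties in any order). -/
def IsEdgeSequence {n : ℕ} {D : Type*} [LinearOrder D] (d : Sym2 (Fin n) → D)
    (F : List (Sym2 (Fin n))) : Prop :=
  ∃ L : List (Sym2 (Fin n)), L.Nodup ∧ (∀ e, e ∈ L ↔ ¬ e.IsDiag) ∧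
    L.Pairwise (fun e f => d e ≤ d f) ∧ scan L = F

/-- `T` lists the edges of a tour found by the heuristic: the included edges in order, followed,
when there are at least three sites, by the edge between the two endpoints of the last fragment. -/
def IsTour {n : ℕ} {D : Type*} [LinearOrder D] (d : Sym2 (Fin n) → D)
    (T : List (Sym2 (Fin n))) : Prop :=
  ∃ F : List (Sym2 (Fin n)), IsEdgeSequence d F ∧ (n < 3 → T = F) ∧
    (3 ≤ n → ∃ u v : Fin n, u ≠ v ∧ IsEndpoint F u ∧ IsEndpoint F v ∧ T = F ++ [s(u, v)])

/-! ### Hierarchical clustering of fragments -/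

/-- Runs of bottom-up (agglomerative) clustering from a set `S` of clusters: while there are two
clusters, choose a closest pair `A`, `B` and replace it by a merged cluster `C`. Here
`merge A B e C` says that `A` and `B` may be merged into `C` with the record `e`, and the list
collects the records. -/
inductive AgglomerativeRun {κ ε Δ : Type*} [DecidableEq κ] [LE Δ] (dist : κ → κ → Δ)
    (merge : κ → κ → ε → κ → Prop) : Finset κ → List ε → Prop
  | done {S : Finset κ} (h : S.card ≤ 1) : AgglomerativeRun dist merge S []
  | step {S : Finset κ} {A B C : κ} {e : ε} {es : List ε}
      (hA : A ∈ S) (hB : B ∈ S) (hAB : A ≠ B)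
      (closest : ∀ X ∈ S, ∀ Y ∈ S, X ≠ Y → dist A B ≤ dist X Y)
      (hC : merge A B e C)
      (rest : AgglomerativeRun dist merge (insert C ((S.erase A).erase B)) es) :
      AgglomerativeRun dist merge S (e :: es)

/-- The endpoints of a fragment, given as the list of its sites along the path. -/
def pathEnds {n : ℕ} (A : List (Fin n)) : Finset (Fin n) :=
  A.head?.toFinset ∪ A.getLast?.toFinset

/-- The length of the shortest edge connecting an endpoint of `A` to an endpoint of `B`. -/
def fragmentDist {n : ℕ} {D : Type*} [LinearOrder D] (d : Sym2 (Fin n) → D)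
    (A B : List (Fin n)) : WithTop D :=
  ((pathEnds A ×ˢ pathEnds B).image (fun p => d s(p.1, p.2))).min

/-- `C` is the path obtained from the paths `A` and `B`, suitably oriented, by adding the edge `e`,
a shortest edge connecting an endpoint of `A` to an endpoint of `B`. -/
def FragmentMerge {n : ℕ} {D : Type*} [LinearOrder D] (d : Sym2 (Fin n) → D)
    (A B : List (Fin n)) (e : Sym2 (Fin n)) (C : List (Fin n)) : Prop :=
  ∃ A' B' : List (Fin n), ∃ a b : Fin n, (A' = A ∨ A' = A.reverse) ∧ (B' = B ∨ B' = B.reverse) ∧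
    A'.getLast? = some a ∧ B'.head? = some b ∧ e = s(a, b) ∧
    (d s(a, b) : WithTop D) = fragmentDist d A B ∧ C = A' ++ B'

/-- `F` is the sequence of edges added by a run of agglomerative clustering of fragments, starting
from the single sites. -/
def IsClusteringSequence {n : ℕ} {D : Type*} [LinearOrder D] (d : Sym2 (Fin n) → D)
    (F : List (Sym2 (Fin n))) : Prop :=
  AgglomerativeRun (fragmentDist d) (FragmentMerge d)
    (Finset.univ.image (fun v : Fin n => [v])) F

/-! ### Closest pairs of fragment endpoints -/

/-- The distance of two different endpoints, where `mate u` is the other endpoint of the fragment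
of `u` (and `mate u = u` for a trivial fragment): infinite within a fragment. -/
def endpointDist {n : ℕ} {D : Type*} (d : Sym2 (Fin n) → D) (mate : Fin n → Fin n)
    (u v : Fin n) : WithTop D :=
  if mate u = v then ⊤ else (d s(u, v) : WithTop D)

/-- Runs of closest-pair selection from the set `P` of fragment endpoints: while some two endpoints
have finite distance, select a closest pair `u`, `v`, delete each of the two that belongs to a
nontrivial fragment, and make the far endpoints of the two fragments mates. -/
inductive EndpointRun {n : ℕ} {D : Type*} [LinearOrder D] (d : Sym2 (Fin n) → D) :
    Finset (Fin n) → (Fin n → Fin n) → List (Sym2 (Fin n)) → Prop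
  | done {P : Finset (Fin n)} {mate : Fin n → Fin n}
      (h : ∀ x ∈ P, ∀ y ∈ P, x ≠ y → endpointDist d mate x y = ⊤) : EndpointRun d P mate []
  | step {P : Finset (Fin n)} {mate : Fin n → Fin n} {u v : Fin n} {F : List (Sym2 (Fin n))}
      (hu : u ∈ P) (hv : v ∈ P) (huv : u ≠ v) (finite : endpointDist d mate u v ≠ ⊤)
      (closest : ∀ x ∈ P, ∀ y ∈ P, x ≠ y → endpointDist d mate u v ≤ endpointDist d mate x y)
      (rest : EndpointRun d
        (P.filter fun w => ¬ (w = u ∧ mate u ≠ u) ∧ ¬ (w = v ∧ mate v ≠ v))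
        (Function.update (Function.update mate (mate u) (mate v)) (mate v) (mate u)) F) :
      EndpointRun d P mate (s(u, v) :: F)

/-- `F` is the sequence of pairs selected by a run of closest-pair selection, starting with every
site as the endpoint of a trivial fragment. -/
def IsEndpointSequence {n : ℕ} {D : Type*} [LinearOrder D] (d : Sym2 (Fin n) → D)
    (F : List (Sym2 (Fin n))) : Prop :=
  EndpointRun d Finset.univ id F

/-! ### The machine model

A random access machine with a distance oracle. A program works on finitely many registers, a
memory, and a write-only output tape. Integers are bounded by a word bound `W`, and the machine
knows the distances only through comparisons of `d(a, b)` with `d(c, e)`. -/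

/-- Arithmetic instructions (natural subtraction is truncated, division is rounded down). -/
inductive ArithOp
  | add | sub | mul | div

/-- The value of an arithmetic instruction. -/
def ArithOp.eval : ArithOp → ℕ → ℕ → ℕ
  | add, a, b => a + b
  | sub, a, b => a - b
  | mul, a, b => a * b
  | div, a, b => a / b

/-- Programs; the natural numbers `x y z a b c e` are names of registers. -/
inductive Program
  /-- do nothing -/
  | skip
  /-- `x := m` for a fixed constant `m` -/
  | const (x m : ℕ)
  /-- `x := y op z` -/
  | arith (op : ArithOp) (x y z : ℕ)
  /-- `x := memory[y]` -/
  | load (x y : ℕ)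
  /-- `memory[x] := y` -/
  | store (x y : ℕ)
  /-- append the pair `(x, y)` to the output -/
  | emit (x y : ℕ)
  /-- `p; q` -/
  | seq (p q : Program)
  /-- `if x < y then p else q` -/
  | ifLt (x y : ℕ) (p q : Program)
  /-- `if d(a, b) ≤ d(c, e) then p else q` -/
  | ifDistLe (a b c e : ℕ) (p q : Program)
  /-- `while x < y do p` -/
  | whileLt (x y : ℕ) (p : Program)

/-- States of the machine. -/
structure State where
  /-- contents of the registers -/
  reg : ℕ → ℕ
  /-- contents of the memory cells -/
  mem : ℕ → ℕ
  /-- the output written so far -/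
  out : List (ℕ × ℕ)

/-- Assign the value `v` to the register `x`. -/
def State.setReg (σ : State) (x v : ℕ) : State :=
  { σ with reg := Function.update σ.reg x v }

/-- The initial state: register `0` holds the number of sites, all else is `0`. -/
def State.init (n : ℕ) : State where
  reg := Function.update (fun _ => 0) 0 n
  mem := fun _ => 0
  out := []

/-- `Exec d W S p σ t σ'`: started in state `σ`, the program `p` halts in state `σ'` after exactly
`t` steps (every instruction and every test is one step); every computed integer is less than `W`,
every memory address that is used is less than `S`, and every distance that is asked for is a
distance of sites. The machine is deterministic, and is stuck when a bound would be violated. -/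
inductive Exec {n : ℕ} {D : Type*} [LinearOrder D] (d : Sym2 (Fin n) → D) (W S : ℕ) :
    Program → State → ℕ → State → Prop
  | skip {σ : State} : Exec d W S .skip σ 1 σ
  | const {σ : State} {x m : ℕ} (h : m < W) : Exec d W S (.const x m) σ 1 (σ.setReg x m)
  | arith {σ : State} {op : ArithOp} {x y z : ℕ} (h : op.eval (σ.reg y) (σ.reg z) < W) :
      Exec d W S (.arith op x y z) σ 1 (σ.setReg x (op.eval (σ.reg y) (σ.reg z)))
  | load {σ : State} {x y : ℕ} (h : σ.reg y < S) :
      Exec d W S (.load x y) σ 1 (σ.setReg x (σ.mem (σ.reg y)))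
  | store {σ : State} {x y : ℕ} (h : σ.reg x < S) :
      Exec d W S (.store x y) σ 1 { σ with mem := Function.update σ.mem (σ.reg x) (σ.reg y) }
  | emit {σ : State} {x y : ℕ} :
      Exec d W S (.emit x y) σ 1 { σ with out := σ.out ++ [(σ.reg x, σ.reg y)] }
  | seq {σ σ' σ'' : State} {p q : Program} {t t' : ℕ} (hp : Exec d W S p σ t σ')
      (hq : Exec d W S q σ' t' σ'') : Exec d W S (.seq p q) σ (t + t') σ''
  | ifLt_true {σ σ' : State} {x y : ℕ} {p q : Program} {t : ℕ} (h : σ.reg x < σ.reg y)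
      (hp : Exec d W S p σ t σ') : Exec d W S (.ifLt x y p q) σ (t + 1) σ'
  | ifLt_false {σ σ' : State} {x y : ℕ} {p q : Program} {t : ℕ} (h : ¬ σ.reg x < σ.reg y)
      (hq : Exec d W S q σ t σ') : Exec d W S (.ifLt x y p q) σ (t + 1) σ'
  | ifDistLe_true {σ σ' : State} {a b c e : ℕ} {p q : Program} {t : ℕ} {i j k l : Fin n}
      (ha : σ.reg a = i) (hb : σ.reg b = j) (hc : σ.reg c = k) (he : σ.reg e = l)
      (h : d s(i, j) ≤ d s(k, l)) (hp : Exec d W S p σ t σ') :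
      Exec d W S (.ifDistLe a b c e p q) σ (t + 1) σ'
  | ifDistLe_false {σ σ' : State} {a b c e : ℕ} {p q : Program} {t : ℕ} {i j k l : Fin n}
      (ha : σ.reg a = i) (hb : σ.reg b = j) (hc : σ.reg c = k) (he : σ.reg e = l)
      (h : ¬ d s(i, j) ≤ d s(k, l)) (hq : Exec d W S q σ t σ') :
      Exec d W S (.ifDistLe a b c e p q) σ (t + 1) σ'
  | while_true {σ σ' σ'' : State} {x y : ℕ} {p : Program} {t t' : ℕ} (h : σ.reg x < σ.reg y)
      (hp : Exec d W S p σ t σ') (hw : Exec d W S (.whileLt x y p) σ' t' σ'') :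
      Exec d W S (.whileLt x y p) σ (t + t' + 1) σ''
  | while_false {σ : State} {x y : ℕ} {p : Program} (h : ¬ σ.reg x < σ.reg y) :
      Exec d W S (.whileLt x y p) σ 1 σ

/-- The output tape `out` lists the edges of `T` in order, each as a pair of sites. -/
def Lists {n : ℕ} (out : List (ℕ × ℕ)) (T : List (Sym2 (Fin n))) : Prop :=
  List.Forall₂ (fun p e => ∃ i j : Fin n, p = ((i : ℕ), (j : ℕ)) ∧ e = s(i, j)) out T

/-- On input `n` and the distance oracle `d`, the program `p` halts within `t` steps, using only
the memory cells with addresses less than `S`, with integers less than `W`, and having written a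
tour of the multiple-fragment heuristic. -/
def FindsTour {n : ℕ} {D : Type*} [LinearOrder D] (p : Program) (d : Sym2 (Fin n) → D)
    (W S t : ℕ) : Prop :=
  ∃ t' ≤ t, ∃ σ : State, Exec d W S p (State.init n) t' σ ∧
    ∃ T : List (Sym2 (Fin n)), IsTour d T ∧ Lists σ.out T

end MultipleFragment

/-! All equivalences pass through one process, `GreedyRun`: repeatedly add a shortest edge among
those that join endpoints of different fragments. Being admissible in this sense is antitone in the
set of chosen edges (`Joins.anti`), so an edge rejected by a scan never becomes admissible later,
and each edge accepted by a sorted scan is a shortest admissible one. The invariants `Represents`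
and `ClusterState` identify the admissible edges with the endpoint pairs at finite distance and with
the pairs of ends of distinct clusters, so the other two processes minimize over the same set.

For the algorithm, edges may be chosen in a different order. An edge that is shortest among the
admissible edges leaving either of the two fragments it joins (`IsLocalStep`) can be added at once.
Under this rule every edge inside a fragment is at most as long as every admissible edge leaving
that fragment (`LocalInv`). Hence when an edge `g` stops being admissible, the edges that block it
are no longer than `g`. At the end, every unchosen edge is blocked by chosen edges that are no
longer than it. A scan that breaks ties in favor of the chosen edges therefore includes exactly
these, in sorted order (`isEdgeSequence_of_blocked`). The converse from greedy runs to scans uses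
the same lemma.

Local steps are found by a nearest-neighbor chain: each link is a shortest edge leaving its
fragment, leads to the fragment of the next link, and is strictly longer than the next link. If the
fragment at the end of the chain has no exit shorter than the last link, that link is a local step.
Adding it deletes endpoints and gives no new exits to other fragments, so the rest of the chain
survives after two links are dropped (`IsNeighborChain.tail`). With weight 3 for a merge and 1 for a
link, the potential shows that there are `O(n)` rounds, each a scan of `O(n)` steps. Selection sort
of the at most `n` edges is again quadratic. The program uses `5 * n` memory cells, so it also
proves the last claim, because `n ^ 2` is `O(n ^ 2 * log ^ 2 n)`. -/

namespace MultipleFragment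

/-! ### Fragments under the addition and deletion of edges. -/

section Graph

variable {n : ℕ} {F F' : List (Sym2 (Fin n))} {u v x y a b : Fin n} {e : Sym2 (Fin n)}

lemma fragmentGraph_adj : (fragmentGraph F).Adj u v ↔ s(u, v) ∈ F ∧ u ≠ v := by
  simp [fragmentGraph]

lemma fragmentGraph_mono (h : F ⊆ F') : fragmentGraph F ≤ fragmentGraph F' := by
  intro u v
  simp only [fragmentGraph_adj]
  exact fun ⟨h₁, h₂⟩ => ⟨h h₁, h₂⟩

lemma IsEndpoint.anti (h : F ⊆ F') (hv : IsEndpoint F' v) : IsEndpoint F v :=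
  Set.Subsingleton.anti hv fun _ hw => fragmentGraph_mono h hw

lemma joins_mk : Joins F s(u, v) ↔
    IsEndpoint F u ∧ IsEndpoint F v ∧ ¬ (fragmentGraph F).Reachable u v := by
  constructor
  · rintro ⟨x, y, h, hx, hy, hxy⟩
    rcases Sym2.eq_iff.1 h with ⟨rfl, rfl⟩ | ⟨rfl, rfl⟩
    · exact ⟨hx, hy, hxy⟩
    · exact ⟨hy, hx, fun h => hxy h.symm⟩
  · rintro ⟨hu, hv, h⟩
    exact ⟨u, v, rfl, hu, hv, h⟩

lemma joins_comm : Joins F s(u, v) ↔ Joins F s(v, u) := by rw [Sym2.eq_swap]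

/-- Adding edges only enlarges neighborhoods and merges components. This monotonicity is used in
both directions: rejected edges stay rejected, and edges that join relative to many edges join
relative to fewer. -/
lemma Joins.anti (h : F ⊆ F') (he : Joins F' e) : Joins F e := by
  obtain ⟨u, v, rfl, hu, hv, huv⟩ := he
  exact ⟨u, v, rfl, hu.anti h, hv.anti h, fun hr => huv (hr.mono (fragmentGraph_mono h))⟩

lemma Joins.ne (h : Joins F s(u, v)) : u ≠ v := by
  rintro rfl
  exact (joins_mk.1 h).2.2 (SimpleGraph.Reachable.refl _)

lemma Joins.not_isDiag (h : Joins F e) : ¬ e.IsDiag := by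
  induction e with
  | h u v => simpa using h.ne

lemma Joins.notMem (h : Joins F e) : e ∉ F := by
  induction e with
  | h u v =>
    intro hm
    exact (joins_mk.1 h).2.2 (SimpleGraph.Adj.reachable (fragmentGraph_adj.2 ⟨hm, h.ne⟩))

/-- A walk that uses the new edge can be shortened so that it crosses it only once. -/
lemma reachable_append_iff : (fragmentGraph (F ++ [s(a, b)])).Reachable x y ↔
    (fragmentGraph F).Reachable x y ∨
      ((fragmentGraph F).Reachable x a ∧ (fragmentGraph F).Reachable b y) ∨
      ((fragmentGraph F).Reachable x b ∧ (fragmentGraph F).Reachable a y) := by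
  have hsub : fragmentGraph F ≤ fragmentGraph (F ++ [s(a, b)]) := fragmentGraph_mono (by simp)
  have hab : (fragmentGraph (F ++ [s(a, b)])).Reachable a b := by
    by_cases h : a = b
    · rw [h]
    · exact SimpleGraph.Adj.reachable (fragmentGraph_adj.2 ⟨by simp, h⟩)
  constructor
  · rintro ⟨w⟩
    induction w with
    | nil => exact Or.inl (SimpleGraph.Reachable.refl _)
    | @cons x z y hxz w ih =>
      obtain ⟨hm, hne⟩ := fragmentGraph_adj.1 hxz
      rcases List.mem_append.1 hm with hm | hm
      · have hr : (fragmentGraph F).Reachable x z :=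
          SimpleGraph.Adj.reachable (fragmentGraph_adj.2 ⟨hm, hne⟩)
        rcases ih with ih | ⟨h₁, h₂⟩ | ⟨h₁, h₂⟩
        · exact Or.inl (hr.trans ih)
        · exact Or.inr (Or.inl ⟨hr.trans h₁, h₂⟩)
        · exact Or.inr (Or.inr ⟨hr.trans h₁, h₂⟩)
      · rcases Sym2.eq_iff.1 (List.mem_singleton.1 hm) with ⟨rfl, rfl⟩ | ⟨rfl, rfl⟩
        · rcases ih with ih | ⟨h₁, h₂⟩ | ⟨h₁, h₂⟩
          · exact Or.inr (Or.inl ⟨SimpleGraph.Reachable.refl _, ih⟩)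
          · exact Or.inr (Or.inl ⟨SimpleGraph.Reachable.refl _, h₂⟩)
          · exact Or.inl h₂
        · rcases ih with ih | ⟨h₁, h₂⟩ | ⟨h₁, h₂⟩
          · exact Or.inr (Or.inr ⟨SimpleGraph.Reachable.refl _, ih⟩)
          · exact Or.inl h₂
          · exact Or.inr (Or.inr ⟨SimpleGraph.Reachable.refl _, h₂⟩)
  · rintro (h | ⟨h₁, h₂⟩ | ⟨h₁, h₂⟩)
    · exact h.mono hsub
    · exact (h₁.mono hsub).trans (hab.trans (h₂.mono hsub))
    · exact (h₁.mono hsub).trans (hab.symm.trans (h₂.mono hsub))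

/-- A walk from `u` survives the deletion of edges outside the component of `u`. -/
lemma reachable_filter {p : Sym2 (Fin n) → Prop} [DecidablePred p]
    (hp : ∀ x y, s(x, y) ∈ F → (fragmentGraph F).Reachable x u → p s(x, y))
    (h : (fragmentGraph F).Reachable u v) :
    (fragmentGraph (F.filter (fun e => p e))).Reachable u v := by
  obtain ⟨w⟩ := h
  induction w with
  | nil => exact SimpleGraph.Reachable.refl _
  | @cons x z y hxz w ih =>
    obtain ⟨hm, hne⟩ := fragmentGraph_adj.1 hxz
    have hr : (fragmentGraph (F.filter (fun e => p e))).Reachable x z :=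
      SimpleGraph.Adj.reachable (fragmentGraph_adj.2
        ⟨by simpa using ⟨hm, hp _ _ hm (SimpleGraph.Reachable.refl _)⟩, hne⟩)
    exact hr.trans (ih fun x' y' hm' hr' => hp x' y' hm' (hr'.trans hxz.symm.reachable))

/-- Whether an edge joins depends only on the edges in the two components of its ends, so a filter
that keeps all of these changes nothing. -/
lemma Joins.of_filter {p : Sym2 (Fin n) → Prop} [DecidablePred p]
    (hu : ∀ x y, s(x, y) ∈ F → (fragmentGraph F).Reachable x u → p s(x, y))
    (hv : ∀ x y, s(x, y) ∈ F → (fragmentGraph F).Reachable x v → p s(x, y))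
    (h : Joins (F.filter (fun e => p e)) s(u, v)) : Joins F s(u, v) := by
  have key : ∀ w, (∀ x y, s(x, y) ∈ F → (fragmentGraph F).Reachable x w → p s(x, y)) →
      IsEndpoint (F.filter (fun e => p e)) w → IsEndpoint F w := by
    intro w hw he
    refine Set.Subsingleton.anti he fun z hz => ?_
    obtain ⟨hm, hne⟩ := fragmentGraph_adj.1 hz
    exact fragmentGraph_adj.2 ⟨by simpa using ⟨hm, hw _ _ hm (SimpleGraph.Reachable.refl _)⟩, hne⟩
  obtain ⟨h₁, h₂, h₃⟩ := joins_mk.1 h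
  exact joins_mk.2 ⟨key u hu h₁, key v hv h₂, fun hr => h₃ (reachable_filter hu hr)⟩

lemma isEndpoint_append_of_ne (ha : v ≠ a) (hb : v ≠ b) :
    IsEndpoint (F ++ [s(a, b)]) v ↔ IsEndpoint F v := by
  have : (fragmentGraph (F ++ [s(a, b)])).neighborSet v = (fragmentGraph F).neighborSet v := by
    ext w
    simp only [SimpleGraph.mem_neighborSet, fragmentGraph_adj, List.mem_append,
      List.mem_singleton, Sym2.eq_iff]
    constructor
    · rintro ⟨h | ⟨h, -⟩ | ⟨h, -⟩, hne⟩
      · exact ⟨h, hne⟩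
      · exact absurd h ha
      · exact absurd h hb
    · rintro ⟨h, hne⟩
      exact ⟨Or.inl h, hne⟩
  rw [IsEndpoint, this, IsEndpoint]

lemma neighborSet_append_self (hab : a ≠ b) :
    (fragmentGraph (F ++ [s(a, b)])).neighborSet a =
      insert b ((fragmentGraph F).neighborSet a) := by
  ext w
  simp only [SimpleGraph.mem_neighborSet, fragmentGraph_adj, List.mem_append,
    List.mem_singleton, Sym2.eq_iff, Set.mem_insert_iff]
  constructor
  · rintro ⟨h | ⟨-, h⟩ | ⟨h, -⟩, hne⟩
    · exact Or.inr ⟨h, hne⟩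
    · exact Or.inl h
    · exact absurd h hab
  · rintro (rfl | ⟨h, hne⟩)
    · exact ⟨Or.inr (by simp), hab⟩
    · exact ⟨Or.inl h, hne⟩

/-- After adding an edge at `a`, the site `a` remains an endpoint iff it was isolated. -/
lemma isEndpoint_append_self (h : Joins F s(a, b)) :
    IsEndpoint (F ++ [s(a, b)]) a ↔ (fragmentGraph F).neighborSet a = ∅ := by
  rw [IsEndpoint, neighborSet_append_self h.ne]
  constructor
  · intro hs
    rw [Set.eq_empty_iff_forall_notMem]
    intro w hw
    have : b = w := hs (by simp) (by simp [hw])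
    subst this
    exact (joins_mk.1 h).2.2 (SimpleGraph.Adj.reachable hw)
  · intro h0
    rw [h0]
    simp

/-- In a union of paths, each edge joins two fragments of the others; this is preserved when an
edge between two fragments is added. -/
lemma joins_filter_append (hF : ∀ f ∈ F, Joins (F.filter (· ≠ f)) f) (h : Joins F e) :
    ∀ f ∈ F ++ [e], Joins ((F ++ [e]).filter (· ≠ f)) f := by
  have end_append : ∀ {x y a b : Fin n}, s(x, y) ∈ F → Joins F s(a, b) → x ≠ y →
      IsEndpoint (F.filter (· ≠ s(x, y))) x →
      IsEndpoint (F.filter (· ≠ s(x, y)) ++ [s(a, b)]) x := by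
    intro x y a b hm hj hne hx
    have key : ∀ {a b : Fin n}, Joins F s(a, b) → x = a →
        IsEndpoint (F.filter (· ≠ s(x, y)) ++ [s(a, b)]) x := by
      rintro a b hj rfl
      -- As an end of a joining edge, `x` has at most one neighbor in `F`, which is `y`; without
      -- `s(x, y)` it is isolated, so it can take the new edge and still be an endpoint.
      refine (isEndpoint_append_self (hj.anti (List.filter_subset_self _))).2 ?_
      rw [Set.eq_empty_iff_forall_notMem]
      intro w hw
      obtain ⟨hwm, hwne⟩ := fragmentGraph_adj.1 hw
      simp only [List.mem_filter, decide_eq_true_eq] at hwm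
      have : w = y := (joins_mk.1 hj).1 (fragmentGraph_adj.2 ⟨hwm.1, hwne⟩)
        (fragmentGraph_adj.2 ⟨hm, hne⟩)
      exact hwm.2 (by rw [this])
    by_cases hxa : x = a
    · exact key hj hxa
    by_cases hxb : x = b
    · rw [Sym2.eq_swap (a := a)]
      exact key (joins_comm.1 hj) hxb
    · exact (isEndpoint_append_of_ne hxa hxb).2 hx
  intro f hf
  by_cases hfe : f = e
  · subst hfe
    refine h.anti fun g hg => ?_
    simp only [List.mem_filter, List.mem_append, List.mem_singleton, decide_eq_true_eq] at hg
    exact hg.1.resolve_right hg.2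
  · have hfF : f ∈ F := by simpa [hfe] using hf
    rw [List.filter_append, List.filter_cons_of_pos (by simpa using Ne.symm hfe), List.filter_nil]
    have hj := hF f hfF
    induction f with
    | h x y =>
      induction e with
      | h a b =>
        obtain ⟨h₁, h₂, h₃⟩ := joins_mk.1 hj
        refine joins_mk.2 ⟨end_append hfF h hj.ne h₁, ?_, ?_⟩
        · rw [Sym2.eq_swap] at hfF h₂ ⊢
          exact end_append hfF h hj.ne.symm h₂
        · have hsub : fragmentGraph (F.filter (· ≠ s(x, y))) ≤ fragmentGraph F :=
            fragmentGraph_mono (List.filter_subset_self _)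
          have hxy : (fragmentGraph F).Reachable x y :=
            SimpleGraph.Adj.reachable (fragmentGraph_adj.2 ⟨hfF, hj.ne⟩)
          -- A detour from `x` to `y` through the new edge would mean that its ends were already
          -- connected in `F`, by way of `s(x, y)`.
          rw [reachable_append_iff]
          rintro (hr | ⟨hr₁, hr₂⟩ | ⟨hr₁, hr₂⟩)
          · exact h₃ hr
          · exact (joins_mk.1 h).2.2
              ((hr₁.mono hsub).symm.trans (hxy.trans (hr₂.mono hsub).symm))
          · exact (joins_mk.1 h).2.2 ((hr₂.mono hsub).trans (hxy.symm.trans (hr₁.mono hsub)))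

end Graph

/-! ### Adding locally shortest edges, and sorting the result into a scan. -/

section LocalGreedy

variable {n : ℕ} {D : Type*} [LinearOrder D] {d : Sym2 (Fin n) → D} {F : List (Sym2 (Fin n))}
  {a b : Fin n} {e : Sym2 (Fin n)}

/-- The edge between `a` and `b` is shortest among the edges that leave their two fragments. -/
def IsLocalStep (d : Sym2 (Fin n) → D) (F : List (Sym2 (Fin n))) (a b : Fin n) : Prop :=
  Joins F s(a, b) ∧ ∀ u v, Joins F s(u, v) →
    (fragmentGraph F).Reachable u a ∨ (fragmentGraph F).Reachable u b → d s(a, b) ≤ d s(u, v)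

/-- The invariant of adding locally shortest edges in any order. -/
structure LocalInv (d : Sym2 (Fin n) → D) (F : List (Sym2 (Fin n))) : Prop where
  nodup : F.Nodup
  joins_filter : ∀ e ∈ F, Joins (F.filter (· ≠ e)) e
  le_of_joins : ∀ u v, Joins F s(u, v) → ∀ x y, s(x, y) ∈ F →
    (fragmentGraph F).Reachable x u → d s(x, y) ≤ d s(u, v)
  blocked : ∀ g, g ∉ F → ¬ g.IsDiag → Joins F g ∨ ¬ Joins (F.filter (d · ≤ d g)) g

lemma LocalInv.nil : LocalInv d [] where
  nodup := List.nodup_nil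
  joins_filter := by simp
  le_of_joins := by simp
  blocked g _ hg := by
    left
    induction g with
    | h u v =>
      have hbot : fragmentGraph ([] : List (Sym2 (Fin n))) = ⊥ := by
        ext
        simp [fragmentGraph_adj]
      refine joins_mk.2 ⟨?_, ?_, ?_⟩
      · simp [IsEndpoint, hbot]
      · simp [IsEndpoint, hbot]
      · rw [hbot, SimpleGraph.reachable_bot]
        simpa using hg

lemma LocalInv.append (h : LocalInv d F) (hs : IsLocalStep d F a b) :
    LocalInv d (F ++ [s(a, b)]) := by
  obtain ⟨hj, hmin⟩ := hs
  have hsub : F ⊆ F ++ [s(a, b)] := by simp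
  -- An old edge in one of the merged fragments is at most as long as `s(a, b)`, which left that
  -- fragment, and `s(a, b)` is at most as long as every other exit. The claim covers all edges
  -- admissible before the step, including those that the step blocks.
  have key : ∀ u v, Joins F s(u, v) → ∀ x y, s(x, y) ∈ F ++ [s(a, b)] →
      (fragmentGraph (F ++ [s(a, b)])).Reachable x u → d s(x, y) ≤ d s(u, v) := by
    intro u v huv x y hm hr
    rcases List.mem_append.1 hm with hm | hm
    · rcases reachable_append_iff.1 hr with hr | ⟨h₁, h₂⟩ | ⟨h₁, h₂⟩
      · exact h.le_of_joins u v huv x y hm hr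
      · exact (h.le_of_joins a b hj x y hm h₁).trans (hmin u v huv (Or.inr h₂.symm))
      · have := h.le_of_joins b a (joins_comm.1 hj) x y hm h₁
        rw [Sym2.eq_swap (a := b)] at this
        exact this.trans (hmin u v huv (Or.inl h₂.symm))
    · rw [List.mem_singleton.1 hm]
      refine hmin u v huv ?_
      rcases Sym2.eq_iff.1 (List.mem_singleton.1 hm) with ⟨rfl, rfl⟩ | ⟨rfl, rfl⟩ <;>
      rcases reachable_append_iff.1 hr with hr | ⟨h₁, h₂⟩ | ⟨h₁, h₂⟩
      exacts [Or.inl hr.symm, Or.inr h₂.symm, Or.inl h₂.symm, Or.inr hr.symm, Or.inr h₂.symm,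
        Or.inl h₂.symm]
  refine ⟨?_, joins_filter_append h.joins_filter hj, ?_, ?_⟩
  · exact h.nodup.append (List.nodup_singleton _) (by simpa using hj.notMem)
  · exact fun u v huv => key u v (huv.anti hsub)
  · intro g hg hd
    by_cases hjg : Joins F g
    -- The edge `g` has just become blocked. By `key`, the new fragments of its ends contain only
    -- edges of length at most `d g`, so the filter keeps everything that blocks it.
    · rw [or_iff_not_imp_left]
      intro hng hf
      induction g with
      | h u v =>
        refine hng (hf.of_filter (key u v hjg) fun x y hm hr => ?_)
        rw [Sym2.eq_swap (a := u)]
        exact key v u (joins_comm.1 hjg) x y hm hr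
    · right
      have := (h.blocked g (fun hm => hg (hsub hm)) hd).resolve_left hjg
      exact fun hf => this (hf.anti (by simp))

lemma scan_append (L : List (Sym2 (Fin n))) [Decidable (Joins (scan L) e)] :
    scan (L ++ [e]) = if Joins (scan L) e then scan L ++ [e] else scan L := by
  simp only [scan, List.foldl_append, List.foldl_cons, List.foldl_nil]
  congr

/-- A final state of the local algorithm, sorted by length, is a sequence of the heuristic. -/
lemma isEdgeSequence_of_blocked {G : List (Sym2 (Fin n))} (hn : G.Nodup)
    (hG : ∀ e ∈ G, Joins (G.filter (· ≠ e)) e) (hsort : G.Pairwise (fun e f => d e ≤ d f))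
    (hb : ∀ g, g ∉ G → ¬ g.IsDiag → ¬ Joins (G.filter (d · ≤ d g)) g) : IsEdgeSequence d G := by
  classical
  -- The index breaks ties: edges of `G` keep their order, and edges outside `G`, whose index is
  -- `G.length`, come after all edges of `G` of the same length.
  let key : Sym2 (Fin n) → D ×ₗ ℕ := fun e => toLex (d e, G.idxOf e)
  let r : Sym2 (Fin n) → Sym2 (Fin n) → Prop := fun e f => key e ≤ key f
  have : Std.Total r := ⟨fun e f => le_total (key e) (key f)⟩
  have : IsTrans _ r := ⟨fun e f g h₁ h₂ => le_trans (α := D ×ₗ ℕ) h₁ h₂⟩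
  let L := (Finset.univ.filter (fun e : Sym2 (Fin n) => ¬ e.IsDiag)).toList.insertionSort r
  have hperm := List.perm_insertionSort r
    (Finset.univ.filter (fun e : Sym2 (Fin n) => ¬ e.IsDiag)).toList
  have hLs : L.Pairwise r := List.pairwise_insertionSort r _
  have hLn : L.Nodup := hperm.nodup_iff.2 (Finset.nodup_toList _)
  have hLm : ∀ e, e ∈ L ↔ ¬ e.IsDiag := fun e => by rw [hperm.mem_iff]; simp
  have hd : ∀ {e f}, r e f → d e ≤ d f := fun {e f} h => by
    rcases Prod.Lex.toLex_le_toLex.1 h with h | h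
    · exact h.le
    · exact h.1.le
  refine ⟨L, hLn, hLm, hLs.imp hd, ?_⟩
  have main : ∀ L₁ L₂, L₁ ++ L₂ = L → scan L₁ = G.filter (· ∈ L₁) := by
    intro L₁
    induction L₁ using List.reverseRecOn with
    | nil => simp [scan]
    | append_singleton L₁ e ih =>
      intro L₂ hL
      rw [List.append_assoc, List.singleton_append] at hL
      rw [scan_append, ih _ hL]
      rw [← hL] at hLn hLs
      have hpre : ∀ f ∈ L₁, r f e := fun f hf =>
        (List.pairwise_append.1 hLs).2.2 f hf e (by simp)
      have hpost : ∀ f ∈ L₂, r e f := (List.pairwise_cons.1 (List.pairwise_append.1 hLs).2.1).1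
      have he1 : e ∉ L₁ := fun h => (List.nodup_append.1 hLn).2.2 e h e (by simp) rfl
      have heD : ¬ e.IsDiag := (hLm e).1 (by rw [← hL]; simp)
      by_cases he : e ∈ G
      -- An edge of `G` joins relative to all others in `G`, hence relative to those scanned before
      -- it.
      · have hj : Joins (G.filter (· ∈ L₁)) e := (hG e he).anti fun f hf => by
          simp only [List.mem_filter, decide_eq_true_eq] at hf ⊢
          exact ⟨hf.1, fun h => he1 (h ▸ hf.2)⟩
        rw [if_pos hj]
        obtain ⟨G₁, G₂, rfl⟩ := List.append_of_mem he
        -- The scan meets the edges of `G` in the order of `G`, so `e` is appended at the right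
        -- place.
        have h₂ : ∀ f ∈ G₂, f ∉ L₁ := by
          intro f hf hfL
          have hle : d e ≤ d f :=
            (List.pairwise_cons.1 (List.pairwise_append.1 hsort).2.1).1 f hf
          rcases Prod.Lex.toLex_le_toLex.1 (hpre f hfL) with h | ⟨-, h⟩
          · exact absurd hle (not_le.2 h)
          · have hn2 := List.nodup_append.1 hn
            have hfe : f ≠ e := fun h => (List.nodup_cons.1 hn2.2.1).1 (h ▸ hf)
            have hf1 : f ∉ G₁ := fun h => hn2.2.2 f h f (by simp [hf]) rfl
            have he1 : e ∉ G₁ := fun h => hn2.2.2 e h e (by simp) rfl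
            rw [List.idxOf_append_of_notMem hf1, List.idxOf_append_of_notMem he1,
              List.idxOf_cons_self, List.idxOf_cons_ne _ (Ne.symm hfe)] at h
            omega
        have hn2 := List.nodup_append.1 hn
        have hfe : ∀ f ∈ G₂, f ≠ e := fun f hf h => (List.nodup_cons.1 hn2.2.1).1 (h ▸ hf)
        have hfe' : ∀ f ∈ G₁, f ≠ e := fun f hf h => hn2.2.2 f hf e (by simp) h
        have e₁ : G₂.filter (· ∈ L₁) = [] := by simpa using h₂
        have e₂ : G₂.filter (· ∈ L₁ ++ [e]) = [] := by
          simpa using fun f hf => ⟨h₂ f hf, hfe f hf⟩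
        have e₃ : G₁.filter (· ∈ L₁ ++ [e]) = G₁.filter (· ∈ L₁) := by
          refine List.filter_congr fun f hf => ?_
          simp [hfe' f hf]
        rw [List.filter_append, List.filter_append, e₃, List.filter_cons_of_neg (by simpa using he1),
          List.filter_cons_of_pos (by simp), e₁, e₂, List.append_nil]
      -- By the choice of the ties, all edges of `G` of length at most `d e` have been scanned
      -- before `e`, and they already block it.
      · have hj : ¬ Joins (G.filter (· ∈ L₁)) e := fun hj => by
          refine hb e he heD (hj.anti fun f hf => ?_)
          simp only [List.mem_filter, decide_eq_true_eq] at hf ⊢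
          refine ⟨hf.1, ?_⟩
          have hfD : ¬ f.IsDiag := (hG f hf.1).not_isDiag
          have hfL : f ∈ L := (hLm f).2 hfD
          have hfe : f ≠ e := fun h => he (h ▸ hf.1)
          by_contra hfn
          rw [← hL] at hfL
          rcases List.mem_append.1 hfL with h | h
          · exact hfn h
          rcases List.mem_cons.1 h with h | h
          · exact hfe h
          rcases Prod.Lex.toLex_le_toLex.1 (hpost f h) with h' | ⟨-, h'⟩
          · exact absurd hf.2 (not_le.2 h')
          · rw [List.idxOf_eq_length he] at h'
            exact absurd (List.idxOf_lt_length_iff.2 hf.1) (not_lt.2 h')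
        rw [if_neg hj]
        refine List.filter_congr fun f hf => ?_
        have hfe : f ≠ e := fun h => he (h ▸ hf)
        simp [hfe]
  rw [main L [] (by simp), List.filter_eq_self]
  intro f hf
  simpa using (hLm f).2 (hG f hf).not_isDiag

end LocalGreedy

/-! ### The greedy process as the common form of all three heuristics. -/

section Runs

variable {n : ℕ} {D : Type*} [LinearOrder D] {d : Sym2 (Fin n) → D}
  {F G : List (Sym2 (Fin n))} {P : Finset (Fin n)} {mate : Fin n → Fin n} {u v w a b : Fin n}

/-- Runs of the greedy algorithm from the set `F` of edges. -/
inductive GreedyRun (d : Sym2 (Fin n) → D) : List (Sym2 (Fin n)) → List (Sym2 (Fin n)) → Prop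
  | done {F : List (Sym2 (Fin n))} (h : ∀ e, ¬ Joins F e) : GreedyRun d F []
  | step {F G : List (Sym2 (Fin n))} {e : Sym2 (Fin n)} (he : Joins F e)
      (hmin : ∀ f, Joins F f → d e ≤ d f) (rest : GreedyRun d (F ++ [e]) G) :
      GreedyRun d F (e :: G)

open Classical in
-- The hypothesis `hL` is the loop invariant: no admissible edge has been passed over. As the list
-- is sorted, an admissible head is then a shortest admissible edge.
lemma exists_greedyRun_of_foldl (L : List (Sym2 (Fin n))) (F : List (Sym2 (Fin n)))
    (hs : L.Pairwise (fun e f => d e ≤ d f)) (hL : ∀ e, Joins F e → e ∈ L) :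
    ∃ G, L.foldl (fun F e => if Joins F e then F ++ [e] else F) F = F ++ G ∧
      GreedyRun d F G := by
  induction L generalizing F with
  | nil => exact ⟨[], by simp, .done fun e he => by simpa using hL e he⟩
  | cons e L ih =>
    obtain ⟨hs₁, hs₂⟩ := List.pairwise_cons.1 hs
    by_cases he : Joins F e
    · obtain ⟨G, hG, hr⟩ := ih (F ++ [e]) hs₂ fun f hf =>
        (List.mem_cons.1 (hL f (hf.anti (by simp)))).resolve_left
          fun h => hf.notMem (by simp [h])
      refine ⟨e :: G, by simp [he, hG], .step he (fun f hf => ?_) hr⟩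
      rcases List.mem_cons.1 (hL f hf) with rfl | h
      · exact le_rfl
      · exact hs₁ f h
    · obtain ⟨G, hG, hr⟩ := ih F hs₂ fun f hf =>
        (List.mem_cons.1 (hL f hf)).resolve_left fun h => he (h ▸ hf)
      exact ⟨G, by simp [he, hG], hr⟩

/-- A globally shortest admissible edge is in particular a local step, and greedy steps have
nondecreasing lengths, so the result needs no sorting. -/
lemma GreedyRun.isEdgeSequence (h : GreedyRun d F G) (hF : LocalInv d F)
    (hs : F.Pairwise (fun e f => d e ≤ d f)) (hj : ∀ f ∈ F, ∀ g, Joins F g → d f ≤ d g) :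
    IsEdgeSequence d (F ++ G) := by
  induction h with
  | @done F h =>
    rw [List.append_nil]
    exact isEdgeSequence_of_blocked hF.nodup hF.joins_filter hs
      fun g hg hd => (hF.blocked g hg hd).resolve_left (h g)
  | @step F G e he hmin _ ih =>
    rw [List.append_cons]
    refine ih ?_ ?_ ?_
    · induction e with
      | h a b => exact hF.append ⟨he, fun u v huv _ => hmin _ huv⟩
    · exact List.pairwise_append.2 ⟨hs, List.pairwise_singleton _ _,
        fun f hf g hg => by rw [List.mem_singleton.1 hg]; exact hj f hf e he⟩
    · intro f hf g hg
      have hg' : Joins F g := hg.anti (by simp)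
      rcases List.mem_append.1 hf with hf | hf
      · exact hj f hf g hg'
      · rw [List.mem_singleton.1 hf]
        exact hmin g hg'

lemma isEdgeSequence_iff_greedyRun : IsEdgeSequence d F ↔ GreedyRun d [] F := by
  constructor
  · rintro ⟨L, -, hm, hs, rfl⟩
    obtain ⟨G, hG, hr⟩ := exists_greedyRun_of_foldl L [] hs fun e he => (hm e).2 he.not_isDiag
    rw [scan, hG]
    exact hr
  · intro h
    exact h.isEdgeSequence LocalInv.nil List.Pairwise.nil (by simp)

/-! ### Endpoints and mates, and closest pairs of endpoints. -/

/-- `P` is the set of fragment endpoints, and `mate u` is the other endpoint of the fragment of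
the endpoint `u`. -/
structure Represents (F : List (Sym2 (Fin n))) (P : Finset (Fin n)) (mate : Fin n → Fin n) :
    Prop where
  mem_iff : ∀ v, v ∈ P ↔ IsEndpoint F v
  mate_mem : ∀ u ∈ P, mate u ∈ P
  mate_mate : ∀ u ∈ P, mate (mate u) = u
  reachable_iff : ∀ u ∈ P, ∀ v ∈ P, (fragmentGraph F).Reachable u v ↔ v = u ∨ v = mate u
  isolated_iff : ∀ u ∈ P, mate u = u ↔ (fragmentGraph F).neighborSet u = ∅
  exists_end : ∀ v, ∃ p ∈ P, (fragmentGraph F).Reachable v p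
  sum_weight : (∑ v, if v ∈ P then if mate v = v then 2 else 1 else 0) + 2 * F.length = 2 * n

/-- The endpoints after the edge between the endpoints `u` and `v` has been added. -/
abbrev nextEnds (P : Finset (Fin n)) (mate : Fin n → Fin n) (u v : Fin n) : Finset (Fin n) :=
  P.filter fun w => ¬ (w = u ∧ mate u ≠ u) ∧ ¬ (w = v ∧ mate v ≠ v)

/-- The mates after the edge between the endpoints `u` and `v` has been added. -/
abbrev nextMate (mate : Fin n → Fin n) (u v : Fin n) : Fin n → Fin n :=
  Function.update (Function.update mate (mate u) (mate v)) (mate v) (mate u)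

lemma Represents.nil : Represents ([] : List (Sym2 (Fin n))) Finset.univ id := by
  have hbot : fragmentGraph ([] : List (Sym2 (Fin n))) = ⊥ := by
    ext
    simp [fragmentGraph_adj]
  refine ⟨?_, by simp, by simp, ?_, ?_, ?_, ?_⟩ <;> simp [IsEndpoint, hbot, eq_comm, mul_comm]

lemma Represents.joins_iff (h : Represents F P mate) :
    Joins F s(u, v) ↔ u ∈ P ∧ v ∈ P ∧ u ≠ v ∧ mate u ≠ v := by
  rw [joins_mk, ← h.mem_iff, ← h.mem_iff]
  constructor
  · rintro ⟨hu, hv, hr⟩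
    rw [h.reachable_iff u hu v hv] at hr
    exact ⟨hu, hv, fun h => hr (Or.inl h.symm), fun h => hr (Or.inr h.symm)⟩
  · rintro ⟨hu, hv, h₁, h₂⟩
    refine ⟨hu, hv, ?_⟩
    rw [h.reachable_iff u hu v hv]
    rintro (h | h)
    · exact h₁ h.symm
    · exact h₂ h.symm

lemma Represents.append (h : Represents F P mate) (hj : Joins F s(u, v)) :
    Represents (F ++ [s(u, v)]) (nextEnds P mate u v) (nextMate mate u v) := by
  obtain ⟨hu, hv, huv, hmuv⟩ := h.joins_iff.1 hj
  have hmu := h.mate_mem u hu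
  have hmv := h.mate_mem v hv
  have hmmu := h.mate_mate u hu
  have hmmv := h.mate_mate v hv
  have hmvu : mate v ≠ u := fun e => hmuv (by rw [← e, hmmv])
  have hmm : mate u ≠ mate v := fun e => huv (by rw [← hmmu, e, hmmv])
  have hm : ∀ w, w ∈ nextEnds P mate u v ↔
      w ∈ P ∧ ¬ (w = u ∧ mate u ≠ u) ∧ ¬ (w = v ∧ mate v ≠ v) := by simp [nextEnds]
  have e1 : nextMate mate u v (mate v) = mate u := by simp [nextMate]
  have e2 : nextMate mate u v (mate u) = mate v := by simp [nextMate, hmm]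
  have e3 : ∀ w, w ≠ mate u → w ≠ mate v → nextMate mate u v w = mate w := by
    intro w h₁ h₂
    simp [nextMate, h₁, h₂]
  have memw : ∀ w ∈ P, w ≠ u → w ≠ v → w ∈ nextEnds P mate u v := by
    intro w hw h₁ h₂
    simp [hm, hw, h₁, h₂]
  have mem_mu : mate u ∈ nextEnds P mate u v := by
    rw [hm]
    exact ⟨hmu, fun h => h.2 h.1, fun h => hmuv h.1⟩
  have mem_mv : mate v ∈ nextEnds P mate u v := by
    rw [hm]
    exact ⟨hmv, fun h => hmvu h.1, fun h => h.2 h.1⟩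
  have cases_mem : ∀ w ∈ nextEnds P mate u v, w = mate u ∨ w = mate v ∨
      (w ∈ P ∧ w ≠ mate u ∧ w ≠ mate v ∧ w ≠ u ∧ w ≠ v) := by
    intro w hw
    obtain ⟨hw, h₁, h₂⟩ := (hm w).1 hw
    grind
  refine ⟨?_, ?_, ?_, ?_, ?_, ?_, ?_⟩
  · intro w
    rw [hm, h.mem_iff]
    by_cases hwu : w = u
    · subst hwu
      rw [isEndpoint_append_self hj, ← h.isolated_iff w hu]
      have := (h.mem_iff w).1 hu
      grind
    by_cases hwv : w = v
    · subst hwv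
      rw [Sym2.eq_swap, isEndpoint_append_self (joins_comm.1 hj), ← h.isolated_iff w hv]
      have := (h.mem_iff w).1 hv
      grind
    · rw [isEndpoint_append_of_ne hwu hwv]
      simp [hwu, hwv]
  · intro w hw
    rcases cases_mem w hw with rfl | rfl | ⟨hwP, h₁, h₂, h₃, h₄⟩
    · rwa [e2]
    · rwa [e1]
    · rw [e3 w h₁ h₂]
      have := h.mate_mate w hwP
      exact memw _ (h.mate_mem w hwP) (by rintro rfl; exact h₁ this.symm)
        (by rintro rfl; exact h₂ this.symm)
  · intro w hw
    rcases cases_mem w hw with rfl | rfl | ⟨hwP, h₁, h₂, h₃, h₄⟩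
    · rw [e2, e1]
    · rw [e1, e2]
    · have := h.mate_mate w hwP
      rw [e3 w h₁ h₂, e3 _ (by grind) (by grind), this]
  · intro x hx y hy
    rw [reachable_append_iff]
    have hxP : x ∈ P := ((hm x).1 hx).1
    have hyP : y ∈ P := ((hm y).1 hy).1
    rw [h.reachable_iff x hxP y hyP, h.reachable_iff x hxP u hu, h.reachable_iff x hxP v hv,
      h.reachable_iff v hv y hyP, h.reachable_iff u hu y hyP]
    have h1 := cases_mem x hx
    have h2 := cases_mem y hy
    have h3 := h.mate_mate x hxP
    have h4 := h.mate_mate y hyP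
    have h5 := e3 x
    have hx' := ((hm x).1 hx).2
    have hy' := ((hm y).1 hy).2
    clear cases_mem memw e3 hm hx hy
    rcases h1 with rfl | rfl | ⟨-, a1, a2, a3, a4⟩
    · rw [e2]; grind
    · rw [e1]; grind
    · rw [h5 a1 a2]; grind
  · intro w hw
    rcases cases_mem w hw with rfl | rfl | ⟨hwP, h₁, h₂, h₃, h₄⟩
    · rw [e2]
      refine ⟨fun e => absurd e.symm hmm, fun e => ?_⟩
      exfalso
      -- If `u` was trivial, `mate u` is `u` itself and has just received an edge; otherwise `mate
      -- u` already had a neighbor.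
      by_cases hmu' : mate u = u
      · rw [hmu', neighborSet_append_self huv] at e
        exact (Set.insert_nonempty _ _).ne_empty e
      · refine hmu' ?_
        have := (h.isolated_iff _ hmu).2 (Set.subset_eq_empty
          (fun z hz => fragmentGraph_mono (by simp) hz) e)
        rw [← this, hmmu]
    · rw [e1]
      refine ⟨fun e => absurd e hmm, fun e => ?_⟩
      exfalso
      by_cases hmv' : mate v = v
      · rw [hmv', Sym2.eq_swap, neighborSet_append_self huv.symm] at e
        exact (Set.insert_nonempty _ _).ne_empty e
      · refine hmv' ?_
        have := (h.isolated_iff _ hmv).2 (Set.subset_eq_empty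
          (fun z hz => fragmentGraph_mono (by simp) hz) e)
        rw [← this, hmmv]
    · rw [e3 w h₁ h₂, h.isolated_iff w hwP]
      have : (fragmentGraph (F ++ [s(u, v)])).neighborSet w =
          (fragmentGraph F).neighborSet w := by
        ext z
        simp [fragmentGraph_adj, h₃, h₄]
      rw [this]
  · intro w
    obtain ⟨p, hp, hr⟩ := h.exists_end w
    have hsub : fragmentGraph F ≤ fragmentGraph (F ++ [s(u, v)]) := fragmentGraph_mono (by simp)
    by_cases hpu : p = u
    · subst hpu
      exact ⟨mate p, mem_mu, (hr.mono hsub).trans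
        (((h.reachable_iff p hu _ hmu).2 (Or.inr rfl)).mono hsub)⟩
    by_cases hpv : p = v
    · subst hpv
      exact ⟨mate p, mem_mv, (hr.mono hsub).trans
        (((h.reachable_iff p hv _ hmv).2 (Or.inr rfl)).mono hsub)⟩
    · exact ⟨p, memw p hp hpu hpv, hr.mono hsub⟩
  -- Each of `u` and `v` loses one unit of weight, and all other sites keep theirs.
  · have hw : ∀ x, (if x ∈ P then if mate x = x then 2 else 1 else 0) =
        (if x ∈ nextEnds P mate u v then if nextMate mate u v x = x then 2 else 1 else 0) +
          (if x = u then 1 else 0) + (if x = v then 1 else 0) := by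
      intro x
      have hx := hm x
      have h5 := e3 x
      by_cases hxu : x = u
      · subst hxu
        clear cases_mem memw e3 hm
        grind
      by_cases hxv : x = v
      · subst hxv
        clear cases_mem memw e3 hm
        grind
      by_cases hxmu : x = mate u
      · subst hxmu
        rw [e2]
        clear cases_mem memw e3 hm
        grind
      by_cases hxmv : x = mate v
      · subst hxmv
        rw [e1]
        clear cases_mem memw e3 hm
        grind
      · rw [h5 hxmu hxmv]
        clear cases_mem memw e3 hm
        grind
    have := h.sum_weight
    simp_rw [hw, Finset.sum_add_distrib] at this
    simp only [Finset.sum_ite_eq', Finset.mem_univ, if_true] at this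
    rw [List.length_append, List.length_singleton]
    omega

/-- The weight in `sum_weight` counts how many more edges a site can take: 2 for an isolated site, 1
for an end of a nontrivial path, 0 inside a path. -/
lemma Represents.length_le (h : Represents F P mate) : F.length ≤ n := by
  have := h.sum_weight
  omega

lemma endpointDist_ne_top {Δ : Type*} {d : Sym2 (Fin n) → Δ} :
    endpointDist d mate u v ≠ ⊤ ↔ mate u ≠ v := by
  unfold endpointDist
  split_ifs with h <;> simp [h]

lemma endpointDist_of_ne {Δ : Type*} {d : Sym2 (Fin n) → Δ} (h : mate u ≠ v) :
    endpointDist d mate u v = (d s(u, v) : WithTop Δ) :=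
  if_neg h

/-- By `Represents.joins_iff`, the pairs of different endpoints at finite distance are exactly the
joining edges. -/
lemma EndpointRun.greedyRun (h : EndpointRun d P mate G) (hF : Represents F P mate) :
    GreedyRun d F G := by
  induction h generalizing F with
  | @done P mate h =>
    refine .done fun e he => ?_
    induction e with
    | h u v =>
      obtain ⟨hu, hv, huv, hm⟩ := hF.joins_iff.1 he
      exact endpointDist_ne_top.2 hm (h u hu v hv huv)
  | @step P mate u v G hu hv huv finite closest _ ih =>
    have hm := endpointDist_ne_top.1 finite
    have hj : Joins F s(u, v) := hF.joins_iff.2 ⟨hu, hv, huv, hm⟩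
    refine .step hj (fun f hf => ?_) (ih (hF.append hj))
    induction f with
    | h x y =>
      obtain ⟨hx, hy, hxy, hmx⟩ := hF.joins_iff.1 hf
      have := closest x hx y hy hxy
      rw [endpointDist_of_ne hm, endpointDist_of_ne hmx] at this
      exact WithTop.coe_le_coe.1 this

lemma GreedyRun.endpointRun (h : GreedyRun d F G) (hF : Represents F P mate) :
    EndpointRun d P mate G := by
  induction h generalizing P mate with
  | @done F h =>
    refine .done fun x hx y hy hxy => ?_
    by_contra hne
    exact h s(x, y) (hF.joins_iff.2 ⟨hx, hy, hxy, endpointDist_ne_top.1 hne⟩)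
  | @step F G e he hmin _ ih =>
    induction e with
    | h u v =>
      obtain ⟨hu, hv, huv, hm⟩ := hF.joins_iff.1 he
      refine .step hu hv huv (endpointDist_ne_top.2 hm) (fun x hx y hy hxy => ?_)
        (ih (hF.append he))
      by_cases hmx : mate x = y
      · rw [endpointDist, endpointDist, if_pos hmx]
        exact le_top
      · rw [endpointDist_of_ne hm, endpointDist_of_ne hmx]
        exact WithTop.coe_le_coe.2 (hmin _ (hF.joins_iff.2 ⟨hx, hy, hxy, hmx⟩))

lemma isEndpointSequence_iff_greedyRun : IsEndpointSequence d F ↔ GreedyRun d [] F :=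
  ⟨fun h => EndpointRun.greedyRun h Represents.nil, fun h => h.endpointRun Represents.nil⟩

/-! ### Clusters of sites given as paths. -/

/-- The clusters in `S` are paths with the endpoints in `P`, matched by `mate`. -/
structure ClusterState (S : Finset (List (Fin n))) (P : Finset (Fin n)) (mate : Fin n → Fin n) :
    Prop where
  ends : ∀ A ∈ S, ∃ a ∈ P, A.head? = some a ∧ A.getLast? = some (mate a)
  cover : ∀ p ∈ P, ∃ A ∈ S, p ∈ pathEnds A
  disjoint : ∀ A ∈ S, ∀ B ∈ S, A ≠ B → Disjoint (pathEnds A) (pathEnds B)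

lemma pathEnds_eq {A : List (Fin n)} (ha : A.head? = some a) (hb : A.getLast? = some b) :
    pathEnds A = {a, b} := by
  ext x
  simp [pathEnds, ha, hb, eq_comm]

lemma fragmentDist_le {A B : List (Fin n)} (ha : a ∈ pathEnds A) (hb : b ∈ pathEnds B) :
    fragmentDist d A B ≤ (d s(a, b) : WithTop D) :=
  Finset.min_le (Finset.mem_image.2 ⟨(a, b), Finset.mem_product.2 ⟨ha, hb⟩, rfl⟩)

lemma le_fragmentDist {A B : List (Fin n)} {t : WithTop D}
    (h : ∀ a ∈ pathEnds A, ∀ b ∈ pathEnds B, t ≤ (d s(a, b) : WithTop D)) :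
    t ≤ fragmentDist d A B := by
  refine Finset.le_min fun m hm => ?_
  obtain ⟨⟨a, b⟩, hab, rfl⟩ := Finset.mem_image.1 hm
  exact h a (Finset.mem_product.1 hab).1 b (Finset.mem_product.1 hab).2

section ClusterState

variable {S : Finset (List (Fin n))} {A B : List (Fin n)}

lemma ClusterState.mem_ends (hS : ClusterState S P mate) (hF : Represents F P mate)
    (hA : A ∈ S) (ha : a ∈ pathEnds A) : a ∈ P ∧ pathEnds A = {a, mate a} := by
  obtain ⟨x, hx, h₁, h₂⟩ := hS.ends A hA
  have he := pathEnds_eq h₁ h₂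
  rw [he] at ha ⊢
  rcases Finset.mem_insert.1 ha with rfl | ha
  · exact ⟨hx, rfl⟩
  · rw [Finset.mem_singleton.1 ha, hF.mate_mate x hx]
    exact ⟨hF.mate_mem x hx, Finset.pair_comm _ _⟩

lemma ClusterState.joins_iff (hS : ClusterState S P mate) (hF : Represents F P mate)
    (hA : A ∈ S) (hB : B ∈ S) (ha : a ∈ pathEnds A) (hb : b ∈ pathEnds B) :
    Joins F s(a, b) ↔ A ≠ B := by
  obtain ⟨haP, hA'⟩ := hS.mem_ends hF hA ha
  obtain ⟨hbP, -⟩ := hS.mem_ends hF hB hb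
  rw [hF.joins_iff]
  constructor
  · rintro ⟨-, -, h₁, h₂⟩ rfl
    rw [hA'] at hb
    rcases Finset.mem_insert.1 hb with h | h
    · exact h₁ h.symm
    · exact h₂ (Finset.mem_singleton.1 h).symm
  · intro hAB
    have hdis := Finset.disjoint_left.1 (hS.disjoint A hA B hB hAB)
    rw [hA'] at hdis
    exact ⟨haP, hbP, fun h => hdis (Finset.mem_insert_self _ _) (h ▸ hb),
      fun h => hdis (Finset.mem_insert_of_mem (Finset.mem_singleton_self _)) (h ▸ hb)⟩

lemma ClusterState.exists_of_joins (hS : ClusterState S P mate) (hF : Represents F P mate)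
    (h : Joins F s(a, b)) :
    ∃ A ∈ S, ∃ B ∈ S, A ≠ B ∧ a ∈ pathEnds A ∧ b ∈ pathEnds B := by
  obtain ⟨ha, hb, -, -⟩ := hF.joins_iff.1 h
  obtain ⟨A, hA, haA⟩ := hS.cover a ha
  obtain ⟨B, hB, hbB⟩ := hS.cover b hb
  exact ⟨A, hA, B, hB, (hS.joins_iff hF hA hB haA hbB).1 h, haA, hbB⟩

/-- A path can be oriented so that it ends in a given endpoint. -/
lemma ClusterState.exists_orientation (hS : ClusterState S P mate)
    (hA : A ∈ S) (ha : a ∈ pathEnds A) :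
    ∃ A', (A' = A ∨ A' = A.reverse) ∧ A'.getLast? = some a := by
  obtain ⟨x, hx, h₁, h₂⟩ := hS.ends A hA
  rw [pathEnds_eq h₁ h₂] at ha
  rcases Finset.mem_insert.1 ha with rfl | ha
  · exact ⟨A.reverse, Or.inr rfl, by rw [List.getLast?_reverse, h₁]⟩
  · exact ⟨A, Or.inl rfl, by rw [h₂, Finset.mem_singleton.1 ha]⟩

lemma ClusterState.head?_of_getLast? (hS : ClusterState S P mate) (hF : Represents F P mate)
    (hA : A ∈ S) {A' : List (Fin n)} (hA' : A' = A ∨ A' = A.reverse)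
    (ha : A'.getLast? = some a) : a ∈ pathEnds A ∧ A'.head? = some (mate a) := by
  obtain ⟨x, hx, h₁, h₂⟩ := hS.ends A hA
  rw [pathEnds_eq h₁ h₂]
  rcases hA' with rfl | rfl
  · rw [h₂] at ha
    obtain rfl := Option.some.inj ha
    exact ⟨by simp, by rw [hF.mate_mate x hx, h₁]⟩
  · rw [List.getLast?_reverse, h₁] at ha
    obtain rfl := Option.some.inj ha
    exact ⟨by simp, by rw [List.head?_reverse, h₂]⟩

/-- The new path runs from `mate a` to `mate b`, which is how `nextMate` pairs them; all other paths
avoid the four sites involved. -/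
lemma ClusterState.merge (hS : ClusterState S P mate) (hF : Represents F P mate)
    (hA : A ∈ S) (hB : B ∈ S) (hAB : A ≠ B) (ha : a ∈ pathEnds A) (hb : b ∈ pathEnds B)
    {C : List (Fin n)} (hC₁ : C.head? = some (mate a)) (hC₂ : C.getLast? = some (mate b)) :
    ClusterState (insert C ((S.erase A).erase B)) (nextEnds P mate a b) (nextMate mate a b) := by
  have hj := (hS.joins_iff hF hA hB ha hb).2 hAB
  have hF' := hF.append hj
  obtain ⟨haP, hbP, hab, hmab⟩ := hF.joins_iff.1 hj
  have hA' := (hS.mem_ends hF hA ha).2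
  have hB' := (hS.mem_ends hF hB hb).2
  have hmma := hF.mate_mate a haP
  have hmmb := hF.mate_mate b hbP
  have hma := hF.mate_mem a haP
  have hmm : mate a ≠ mate b := fun e => hab (by rw [← hmma, e, hmmb])
  have hmba : mate b ≠ a := fun e => hmab (by rw [← e, hmmb])
  have hCe := pathEnds_eq hC₁ hC₂
  have hX : ∀ X ∈ (S.erase A).erase B, X ∈ S ∧ X ≠ A ∧ X ≠ B := by
    intro X hX
    simp only [Finset.mem_erase] at hX
    exact ⟨hX.2.2, hX.2.1, hX.1⟩
  have hXe : ∀ X ∈ (S.erase A).erase B, ∀ x ∈ pathEnds X,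
      x ≠ a ∧ x ≠ mate a ∧ x ≠ b ∧ x ≠ mate b := by
    intro X hX' x hx
    obtain ⟨hXS, hXA, hXB⟩ := hX X hX'
    have d₁ := Finset.disjoint_left.1 (hS.disjoint X hXS A hA hXA) hx
    have d₂ := Finset.disjoint_left.1 (hS.disjoint X hXS B hB hXB) hx
    rw [hA'] at d₁
    rw [hB'] at d₂
    simpa [and_assoc] using And.intro d₁ d₂
  have hCX : ∀ X ∈ (S.erase A).erase B, Disjoint (pathEnds C) (pathEnds X) := by
    intro X hX'
    rw [Finset.disjoint_right, hCe]
    intro x hx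
    have := hXe X hX' x hx
    simp [this.2.1, this.2.2.2]
  refine ⟨?_, ?_, ?_⟩
  · intro X hX'
    rcases Finset.mem_insert.1 hX' with rfl | hX'
    · refine ⟨mate a, ?_, hC₁, ?_⟩
      · rw [Finset.mem_filter]
        exact ⟨hma, fun h => h.2 h.1, fun h => hmab h.1⟩
      · rw [hC₂]
        simp [nextMate, hmm]
    · obtain ⟨x, hx, h₁, h₂⟩ := hS.ends X (hX X hX').1
      obtain ⟨n₁, n₂, n₃, n₄⟩ := hXe X hX' x (by rw [pathEnds_eq h₁ h₂]; simp)
      refine ⟨x, ?_, h₁, ?_⟩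
      · rw [Finset.mem_filter]
        exact ⟨hx, fun h => n₁ h.1, fun h => n₃ h.1⟩
      · rw [h₂]
        simp [nextMate, n₂, n₄]
  · intro p hp
    obtain ⟨hp, hpa, hpb⟩ := Finset.mem_filter.1 hp
    obtain ⟨X, hXS, hpX⟩ := hS.cover p hp
    by_cases hXA : X = A
    · refine ⟨C, Finset.mem_insert_self _ _, ?_⟩
      rw [hXA, hA'] at hpX
      rw [hCe]
      grind
    by_cases hXB : X = B
    · refine ⟨C, Finset.mem_insert_self _ _, ?_⟩
      rw [hXB, hB'] at hpX
      rw [hCe]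
      grind
    · exact ⟨X, by simp [hXA, hXB, hXS], hpX⟩
  · intro X hX' Y hY' hXY
    rcases Finset.mem_insert.1 hX' with rfl | hX₁ <;>
      rcases Finset.mem_insert.1 hY' with rfl | hY₁
    · exact absurd rfl hXY
    · exact hCX Y hY₁
    · exact (hCX X hX₁).symm
    · exact hS.disjoint X (hX X hX₁).1 Y (hX Y hY₁).1 hXY

lemma ClusterState.greedyRun
    (h : AgglomerativeRun (fragmentDist d) (FragmentMerge d) S G)
    (hS : ClusterState S P mate) (hF : Represents F P mate) : GreedyRun d F G := by
  induction h generalizing F P mate with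
  | @done S h =>
    refine .done fun e he => ?_
    induction e with
    | h u v =>
      obtain ⟨A, hA, B, hB, hAB, -⟩ := hS.exists_of_joins hF he
      exact hAB (Finset.card_le_one.1 h A hA B hB)
  | @step S A B C e G hA hB hAB closest hC _ ih =>
    obtain ⟨A', B', a, b, hA', hB', ha, hb, rfl, hd, rfl⟩ := hC
    obtain ⟨haA, ha'⟩ := hS.head?_of_getLast? hF hA hA' ha
    -- In a merge, `b` is the first site of `B'`; reversal makes it the last one, so that the same
    -- orientation lemma applies to both paths.
    have hB'' : B'.reverse = B ∨ B'.reverse = B.reverse := by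
      rcases hB' with rfl | rfl
      · exact Or.inr rfl
      · exact Or.inl (List.reverse_reverse _)
    obtain ⟨hbB, hb'⟩ := hS.head?_of_getLast? hF hB hB'' (by rw [List.getLast?_reverse, hb])
    rw [List.head?_reverse] at hb'
    have hj := (hS.joins_iff hF hA hB haA hbB).2 hAB
    refine .step hj (fun f hf => ?_) (ih (hS.merge hF hA hB hAB haA hbB ?_ ?_) (hF.append hj))
    · induction f with
      | h x y =>
        obtain ⟨X, hX, Y, hY, hXY, hx, hy⟩ := hS.exists_of_joins hF hf
        rw [← WithTop.coe_le_coe, hd]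
        exact (closest X hX Y hY hXY).trans (fragmentDist_le hx hy)
    · rw [List.head?_append, ha']
      rfl
    · rw [List.getLast?_append, hb']
      rfl

lemma GreedyRun.agglomerativeRun (h : GreedyRun d F G) (hS : ClusterState S P mate)
    (hF : Represents F P mate) :
    AgglomerativeRun (fragmentDist d) (FragmentMerge d) S G := by
  induction h generalizing S P mate with
  | @done F h =>
    refine .done (Finset.card_le_one.2 fun A hA B hB => ?_)
    by_contra hAB
    obtain ⟨a, -, ha, ha'⟩ := hS.ends A hA
    obtain ⟨b, -, hb, hb'⟩ := hS.ends B hB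
    exact h s(a, b) ((hS.joins_iff hF hA hB (by rw [pathEnds_eq ha ha']; simp)
      (by rw [pathEnds_eq hb hb']; simp)).2 hAB)
  | @step F G e he hmin _ ih =>
    induction e with
    | h a b =>
      obtain ⟨A, hA, B, hB, hAB, haA, hbB⟩ := hS.exists_of_joins hF he
      obtain ⟨A', hA', ha⟩ := hS.exists_orientation hA haA
      obtain ⟨B', hB', hb⟩ := hS.exists_orientation hB hbB
      have ha' := (hS.head?_of_getLast? hF hA hA' ha).2
      have hb' := (hS.head?_of_getLast? hF hB hB' hb).2
      have hle : ∀ X ∈ S, ∀ Y ∈ S, X ≠ Y → (d s(a, b) : WithTop D) ≤ fragmentDist d X Y := by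
        intro X hX Y hY hXY
        exact le_fragmentDist fun x hx y hy => WithTop.coe_le_coe.2
          (hmin _ ((hS.joins_iff hF hX hY hx hy).2 hXY))
      refine .step hA hB hAB (fun X hX Y hY hXY => (fragmentDist_le haA hbB).trans
        (hle X hX Y hY hXY)) (C := A' ++ B'.reverse)
        ⟨A', B'.reverse, a, b, hA', ?_, ha, by rw [List.head?_reverse, hb], rfl,
          (hle A hA B hB hAB).antisymm (fragmentDist_le haA hbB), rfl⟩
        (ih (hS.merge hF hA hB hAB haA hbB ?_ ?_) (hF.append he))
      · rcases hB' with rfl | rfl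
        · exact Or.inr rfl
        · exact Or.inl (List.reverse_reverse _)
      · rw [List.head?_append, ha']
        rfl
      · rw [List.getLast?_append, List.getLast?_reverse, hb']
        rfl

end ClusterState

lemma ClusterState.singletons :
    ClusterState (Finset.univ.image fun v : Fin n => [v]) Finset.univ id := by
  refine ⟨?_, ?_, ?_⟩
  · intro A hA
    obtain ⟨v, -, rfl⟩ := Finset.mem_image.1 hA
    exact ⟨v, Finset.mem_univ _, rfl, rfl⟩
  · intro p _
    exact ⟨[p], by simp, by simp [pathEnds]⟩
  · intro A hA B hB hAB
    obtain ⟨v, -, rfl⟩ := Finset.mem_image.1 hA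
    obtain ⟨w, -, rfl⟩ := Finset.mem_image.1 hB
    have : v ≠ w := fun h => hAB (by rw [h])
    simp [pathEnds, this]

lemma isClusteringSequence_iff_greedyRun : IsClusteringSequence d F ↔ GreedyRun d [] F :=
  ⟨fun h => ClusterState.singletons.greedyRun h Represents.nil,
    fun h => h.agglomerativeRun ClusterState.singletons Represents.nil⟩

end Runs

/-! ### Nearest-neighbor chains of fragments. -/

section Chain

variable {n : ℕ} {D : Type*} [LinearOrder D] {d : Sym2 (Fin n) → D}
  {F : List (Sym2 (Fin n))} {P : Finset (Fin n)} {mate : Fin n → Fin n} {x : Fin n}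
  {p q : Fin n × Fin n} {K : List (Fin n × Fin n)}

/-- The edge of a pair of sites. -/
def pairEdge (p : Fin n × Fin n) : Sym2 (Fin n) := s(p.1, p.2)

/-- The pair `p` leads from an endpoint of the fragment of `x` to an endpoint of another one. -/
def Leaves (P : Finset (Fin n)) (mate : Fin n → Fin n) (x : Fin n) (p : Fin n × Fin n) : Prop :=
  (p.1 = x ∨ p.1 = mate x) ∧ p.2 ∈ P ∧ p.2 ≠ x ∧ p.2 ≠ mate x

/-- The pair `p` is a shortest one that leaves the fragment of its first site. -/
def IsShortestLeaving (d : Sym2 (Fin n) → D) (P : Finset (Fin n)) (mate : Fin n → Fin n)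
    (p : Fin n × Fin n) : Prop :=
  p.1 ∈ P ∧ Leaves P mate p.1 p ∧ ∀ q, Leaves P mate p.1 q → d (pairEdge p) ≤ d (pairEdge q)

/-- A nearest-neighbor chain, with its last link first. -/
structure IsNeighborChain (d : Sym2 (Fin n) → D) (P : Finset (Fin n)) (mate : Fin n → Fin n)
    (K : List (Fin n × Fin n)) : Prop where
  shortest : ∀ p ∈ K, IsShortestLeaving d P mate p
  decreasing : K.Pairwise fun p q => d (pairEdge p) < d (pairEdge q)
  linked : K.IsChain fun p q => p.1 = q.2 ∨ p.1 = mate q.2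

lemma IsNeighborChain.nil : IsNeighborChain d P mate [] :=
  ⟨by simp, List.Pairwise.nil, .nil⟩

/-- Two links with the same first site would both be shortest exits of one fragment, against the
strict decrease; so the first sites are distinct. -/
lemma IsNeighborChain.length_le (h : IsNeighborChain d P mate K) : K.length ≤ n := by
  have : (K.map Prod.fst).Nodup := by
    rw [List.Nodup, List.pairwise_map]
    refine h.decreasing.imp_of_mem fun {p q} hp hq hlt heq => ?_
    exact absurd ((h.shortest q hq).2.2 p (heq ▸ (h.shortest p hp).2.1)) (not_le.2 hlt)
  simpa using this.length_le_card

lemma Leaves.joins (hF : Represents F P mate) (hx : x ∈ P) (h : Leaves P mate x p) :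
    Joins F (pairEdge p) := by
  obtain ⟨h₁, h₂, h₃, h₄⟩ := h
  refine hF.joins_iff.2 ?_
  rcases h₁ with h | h <;> rw [h]
  · exact ⟨hx, h₂, h₃.symm, h₄.symm⟩
  · exact ⟨hF.mate_mem x hx, h₂, h₄.symm, by rw [hF.mate_mate x hx]; exact h₃.symm⟩

/-- The exits belong to the fragment, not to the endpoint by which it is named. -/
lemma leaves_mate (hF : Represents F P mate) (hx : x ∈ P) :
    Leaves P mate (mate x) p ↔ Leaves P mate x p := by
  unfold Leaves
  rw [hF.mate_mate x hx]
  tauto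

lemma Leaves.fst_mem (hF : Represents F P mate) (hx : x ∈ P) (h : Leaves P mate x p) :
    p.1 ∈ P := by
  rcases h.1 with h | h <;> rw [h]
  · exact hx
  · exact hF.mate_mem x hx

lemma leaves_of_joins (hF : Represents F P mate) (h : Joins F (pairEdge p))
    (hx : p.1 = x ∨ p.1 = mate x) (hxP : x ∈ P) : Leaves P mate x p := by
  obtain ⟨h₁, h₂, h₃, h₄⟩ := hF.joins_iff.1 h
  refine ⟨hx, h₂, ?_⟩
  rcases hx with hx | hx <;> rw [hx] at h₃ h₄
  · exact ⟨h₃.symm, h₄.symm⟩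
  · rw [hF.mate_mate x hxP] at h₄
    exact ⟨h₄.symm, h₃.symm⟩

lemma IsNeighborChain.cons (hF : Represents F P mate) (h : IsNeighborChain d P mate K)
    (hx : x ∈ P) (hK : ∀ q ∈ K.head?, x = q.2) (hp : Leaves P mate x p)
    (hmin : ∀ q, Leaves P mate x q → d (pairEdge p) ≤ d (pairEdge q))
    (hlt : ∀ q ∈ K.head?, d (pairEdge p) < d (pairEdge q)) :
    IsNeighborChain d P mate (p :: K) := by
  have hL : ∀ q, Leaves P mate p.1 q ↔ Leaves P mate x q := by
    intro q
    rcases hp.1 with h | h <;> rw [h]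
    exact leaves_mate hF hx
  refine ⟨?_, ?_, ?_⟩
  · intro q hq
    rcases List.mem_cons.1 hq with rfl | hq
    · exact ⟨hp.fst_mem hF hx, (hL q).2 hp, fun q' hq' => hmin q' ((hL q').1 hq')⟩
    · exact h.shortest q hq
  · refine List.pairwise_cons.2 ⟨fun q hq => ?_, h.decreasing⟩
    cases K with
    | nil => simp at hq
    | cons q' K =>
      have h' := hlt q' rfl
      rcases List.mem_cons.1 hq with rfl | hq
      · exact h'
      · exact h'.trans ((List.pairwise_cons.1 h.decreasing).1 q hq)
  · refine List.isChain_cons.2 ⟨fun q hq => ?_, h.linked⟩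
    rw [← hK q hq]
    exact hp.1

lemma exists_rel_of_isChain {α : Type*} {R : α → α → Prop} {a : α} {l : List α}
    (h : (a :: l).IsChain R) : ∀ b ∈ l, ∃ c ∈ a :: l, R c b := by
  induction l generalizing a with
  | nil => simp
  | cons b l ih =>
    obtain ⟨h₁, h₂⟩ := List.isChain_cons_cons.1 h
    intro c hc
    rcases List.mem_cons.1 hc with rfl | hc
    · exact ⟨a, by simp, h₁⟩
    · obtain ⟨c', hc', hr⟩ := ih h₂ c hc
      exact ⟨c', by simp [hc'], hr⟩

/-- The last link of the chain can be added if the last fragment has no shorter way out. -/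
lemma IsNeighborChain.isLocalStep (hF : Represents F P mate)
    (h : IsNeighborChain d P mate (p :: K))
    (hmin : ∀ q, Leaves P mate p.2 q → d (pairEdge p) ≤ d (pairEdge q)) :
    IsLocalStep d F p.1 p.2 := by
  obtain ⟨hp, hl, hs⟩ := h.shortest p (by simp)
  have hj := hl.joins hF hp
  refine ⟨hj, fun u v huv hr => ?_⟩
  have hu := (hF.joins_iff.1 huv).1
  rcases hr with hr | hr
  · rw [hF.reachable_iff u hu _ hp] at hr
    refine hs (u, v) (leaves_of_joins hF huv ?_ hp)
    rcases hr with hr | hr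
    · exact Or.inl hr.symm
    · exact Or.inr (by rw [hr, hF.mate_mate u hu])
  · rw [hF.reachable_iff u hu _ hl.2.1] at hr
    refine hmin (u, v) (leaves_of_joins hF huv ?_ hl.2.1)
    rcases hr with hr | hr
    · exact Or.inl hr.symm
    · exact Or.inr (by rw [hr, hF.mate_mate u hu])

/-- When the last link of the chain is added, the chain loses this link and the one before. -/
lemma IsNeighborChain.tail (hF : Represents F P mate) (h : IsNeighborChain d P mate (p :: K)) :
    IsNeighborChain d (nextEnds P mate p.1 p.2) (nextMate mate p.1 p.2) K.tail := by
  obtain ⟨hp, hl, hs⟩ := h.shortest p (by simp)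
  have hj := hl.joins hF hp
  obtain ⟨hlt, hdec⟩ := List.pairwise_cons.1 h.decreasing
  cases K with
  | nil => exact .nil
  | cons p' K =>
    have hmm1 := hF.mate_mate p.1 hp
    have hmm2 := hF.mate_mate p.2 hl.2.1
    -- No earlier link starts in a merged fragment, since `p`, in one of its directions, would be a
    -- shorter exit from there.
    have hfst : ∀ q ∈ p' :: K, q.1 ≠ p.1 ∧ q.1 ≠ mate p.1 ∧ q.1 ≠ p.2 ∧ q.1 ≠ mate p.2 := by
      intro q hq
      have hlq := hlt q hq
      obtain ⟨hqP, hql, hqs⟩ := h.shortest q (List.mem_cons_of_mem _ hq)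
      have key : ∀ {a b : Fin n}, d s(a, b) = d (pairEdge p) → Joins F s(a, b) → a ∈ P →
          q.1 ≠ a ∧ q.1 ≠ mate a := by
        intro a b hd hab haP
        have : ¬ (a = q.1 ∨ a = mate q.1) := fun ha =>
          absurd (hqs (a, b) (leaves_of_joins hF hab ha hqP)) (not_le.2 (hd ▸ hlq))
        push Not at this
        exact ⟨this.1.symm, fun e => this.2 (by rw [e, hF.mate_mate a haP])⟩
      obtain ⟨h₁, h₂⟩ := key rfl hj hp
      obtain ⟨h₃, h₄⟩ := key (by rw [Sym2.eq_swap]; rfl) (joins_comm.1 hj) hl.2.1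
      exact ⟨h₁, h₂, h₃, h₄⟩
    have hlink := (List.isChain_cons_cons.1 h.linked).2
    -- The target of such a link is the fragment in which the next link starts. This fails for `p'`,
    -- whose target is merged, and therefore `p'` is dropped as well.
    have hsnd : ∀ q ∈ K, q.2 ≠ p.1 ∧ q.2 ≠ mate p.1 ∧ q.2 ≠ p.2 ∧ q.2 ≠ mate p.2 := by
      intro q hq
      obtain ⟨c, hc, hcq⟩ := exists_rel_of_isChain hlink q hq
      obtain ⟨h₁, h₂, h₃, h₄⟩ := hfst c hc
      have hq2 := (h.shortest q (by simp [hq])).2.1.2.1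
      rcases hcq with e | e
      · rw [← e]
        exact ⟨h₁, h₂, h₃, h₄⟩
      · rw [← hF.mate_mate q.2 hq2, ← e]
        have hmm := hF.mate_mate c.1 (h.shortest c (List.mem_cons_of_mem _ hc)).1
        exact ⟨fun e => h₂ (by rw [← e, hmm]), fun e => h₁ (by rw [← hmm, e, hmm1]),
          fun e => h₄ (by rw [← e, hmm]), fun e => h₃ (by rw [← hmm, e, hmm2])⟩
    rw [List.tail_cons]
    refine ⟨?_, (List.pairwise_cons.1 hdec).2, ?_⟩
    · intro q hq
      obtain ⟨hqP, hql, hqs⟩ := h.shortest q (by simp [hq])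
      obtain ⟨h₁, h₂, h₃, h₄⟩ := hfst q (by simp [hq])
      obtain ⟨k₁, k₂, k₃, k₄⟩ := hsnd q hq
      have hm : nextMate mate p.1 p.2 q.1 = mate q.1 := by simp [nextMate, h₂, h₄]
      refine ⟨?_, ?_, ?_⟩
      · simp [nextEnds, hqP, h₁, h₃]
      · refine ⟨Or.inl rfl, ?_, hql.2.2.1, ?_⟩
        · simp [nextEnds, hql.2.1, k₁, k₃]
        · rw [hm]
          exact hql.2.2.2
      -- The merge only deletes endpoints, so an exit of an untouched fragment was one before.
      · rintro q' ⟨l₁, l₂, l₃, l₄⟩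
        rw [hm] at l₁ l₄
        exact hqs q' ⟨l₁, (Finset.mem_filter.1 l₂).1, l₃, l₄⟩
    · have hlink' := (List.isChain_cons.1 hlink).2
      refine List.IsChain.imp_of_mem_imp (fun c q _ hq hcq => ?_) hlink'
      obtain ⟨k₁, k₂, k₃, k₄⟩ := hsnd q hq
      have hm : nextMate mate p.1 p.2 q.2 = mate q.2 := by simp [nextMate, k₂, k₄]
      rwa [hm]

/-- If nothing leaves the fragment of `x`, then it is the last fragment. -/
lemma eq_or_eq_mate_of_not_leaves
    (h : ∀ p, ¬ Leaves P mate x p) {y : Fin n} (hy : y ∈ P) : y = x ∨ y = mate x := by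
  by_contra hne
  push Not at hne
  exact h (x, y) ⟨Or.inl rfl, hy, hne.1, hne.2⟩

lemma Represents.not_joins (hF : Represents F P mate) (hx : x ∈ P)
    (h : ∀ p, ¬ Leaves P mate x p) (e : Sym2 (Fin n)) : ¬ Joins F e := by
  induction e with
  | h u v =>
    intro hj
    exact h (u, v) (leaves_of_joins hF hj (eq_or_eq_mate_of_not_leaves h (hF.joins_iff.1 hj).1) hx)

/-- If the last fragment were the single site `x`, it would be isolated; but the fragment of any
other site has an endpoint, which can only be `x`. -/
lemma Represents.mate_ne (hF : Represents F P mate) (hx : x ∈ P)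
    (h : ∀ p, ¬ Leaves P mate x p) (hn : 2 ≤ n) : x ≠ mate x := by
  intro he
  have : Nontrivial (Fin n) := Fin.nontrivial_iff_two_le.2 hn
  obtain ⟨y, hy⟩ := exists_ne x
  obtain ⟨p, hp, hr⟩ := hF.exists_end y
  have hpx : p = x := (eq_or_eq_mate_of_not_leaves h hp).elim id fun h => h.trans he.symm
  rw [hpx] at hr
  obtain ⟨w⟩ := hr.symm
  have h0 := (hF.isolated_iff x hx).1 he.symm
  cases w with
  | nil => exact hy rfl
  | cons hadj _ =>
    have : _ ∈ (fragmentGraph F).neighborSet x := hadj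
    rw [h0] at this
    exact this

end Chain

/-! ### States of the machine and rules for running times. -/

@[simp]
lemma State.setReg_reg (σ : State) (x v y : ℕ) :
    (σ.setReg x v).reg y = if y = x then v else σ.reg y := by
  simp [State.setReg, Function.update_apply]

@[simp]
lemma State.setReg_mem (σ : State) (x v : ℕ) : (σ.setReg x v).mem = σ.mem := rfl

@[simp]
lemma State.setReg_out (σ : State) (x v : ℕ) : (σ.setReg x v).out = σ.out := rfl

/-- Assign the value `v` to the memory cell `a`. -/
def State.setMem (σ : State) (a v : ℕ) : State := { σ with mem := Function.update σ.mem a v }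

@[simp]
lemma State.setMem_reg (σ : State) (a v : ℕ) : (σ.setMem a v).reg = σ.reg := rfl

@[simp]
lemma State.setMem_mem (σ : State) (a v b : ℕ) :
    (σ.setMem a v).mem b = if b = a then v else σ.mem b := by
  simp [State.setMem, Function.update_apply]

@[simp]
lemma State.setMem_out (σ : State) (a v : ℕ) : (σ.setMem a v).out = σ.out := rfl

/-- Append a pair to the output. -/
def State.append (σ : State) (a b : ℕ) : State := { σ with out := σ.out ++ [(a, b)] }

@[simp]
lemma State.append_reg (σ : State) (a b : ℕ) : (σ.append a b).reg = σ.reg := rfl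

@[simp]
lemma State.append_mem (σ : State) (a b : ℕ) : (σ.append a b).mem = σ.mem := rfl

@[simp]
lemma State.append_out (σ : State) (a b : ℕ) : (σ.append a b).out = σ.out ++ [(a, b)] := rfl

/-- Sequential composition of a list of programs. -/
def block : List Program → Program
  | [] => .skip
  | p :: l => .seq p (block l)

section Wp

variable {n : ℕ} {D : Type*} [LinearOrder D] {d : Sym2 (Fin n) → D} {W S : ℕ}

/-- Started in `σ`, the program `p` halts within `t` steps in a state that satisfies `Q`. -/
def Wp (d : Sym2 (Fin n) → D) (W S : ℕ) (p : Program) (t : ℕ) (Q : State → Prop) (σ : State) :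
    Prop :=
  ∃ t' ≤ t, ∃ σ', Exec d W S p σ t' σ' ∧ Q σ'

variable {p q : Program} {l : List Program} {t t₁ t₂ : ℕ} {Q R : State → Prop} {σ : State}
  {x y z m : ℕ}

lemma Wp.mono (h : Wp d W S p t₁ R σ) (ht : t₁ ≤ t) (hQ : ∀ σ', R σ' → Q σ') :
    Wp d W S p t Q σ := by
  obtain ⟨t', ht', σ', he, hR⟩ := h
  exact ⟨t', ht'.trans ht, σ', he, hQ σ' hR⟩

lemma Wp.skip (h : Q σ) : Wp d W S .skip (t + 1) Q σ := ⟨1, by omega, σ, .skip, h⟩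

lemma Wp.nil (h : Q σ) : Wp d W S (block []) (t + 1) Q σ := Wp.skip h

lemma Wp.cons (hp : Wp d W S p t₁ R σ) (hl : ∀ σ', R σ' → Wp d W S (block l) t₂ Q σ')
    (ht : t₁ + t₂ ≤ t) : Wp d W S (block (p :: l)) t Q σ := by
  obtain ⟨t', ht', σ', he, hR⟩ := hp
  obtain ⟨t'', ht'', σ'', he', hQ⟩ := hl σ' hR
  exact ⟨t' + t'', by omega, σ'', .seq he he', hQ⟩

lemma Wp.const (hm : m < W) (h : Wp d W S (block l) t Q (σ.setReg x m)) :
    Wp d W S (block (.const x m :: l)) (t + 1) Q σ :=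
  Wp.cons (t₁ := 1) ⟨1, le_rfl, _, .const hm, rfl⟩ (fun _ e => e ▸ h) (by omega)

lemma Wp.arith {op : ArithOp} (v : ℕ) (hv : op.eval (σ.reg y) (σ.reg z) = v) (hW : v < W)
    (h : Wp d W S (block l) t Q (σ.setReg x v)) :
    Wp d W S (block (.arith op x y z :: l)) (t + 1) Q σ := by
  subst hv
  exact Wp.cons (t₁ := 1) ⟨1, le_rfl, _, .arith hW, rfl⟩ (fun _ e => e ▸ h) (by omega)

lemma Wp.load (a v : ℕ) (ha : σ.reg y = a) (hS : a < S) (hv : σ.mem a = v)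
    (h : Wp d W S (block l) t Q (σ.setReg x v)) :
    Wp d W S (block (.load x y :: l)) (t + 1) Q σ := by
  subst ha hv
  exact Wp.cons (t₁ := 1) ⟨1, le_rfl, _, .load hS, rfl⟩ (fun _ e => e ▸ h) (by omega)

lemma Wp.store (a v : ℕ) (ha : σ.reg x = a) (hS : a < S) (hv : σ.reg y = v)
    (h : Wp d W S (block l) t Q (σ.setMem a v)) :
    Wp d W S (block (.store x y :: l)) (t + 1) Q σ := by
  subst ha hv
  exact Wp.cons (t₁ := 1) (R := fun σ' => σ' = σ.setMem (σ.reg x) (σ.reg y))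
    ⟨1, le_rfl, _, .store hS, rfl⟩ (fun _ e => e ▸ h) (by omega)

lemma Wp.emit (a b : ℕ) (ha : σ.reg x = a) (hb : σ.reg y = b)
    (h : Wp d W S (block l) t Q (σ.append a b)) :
    Wp d W S (block (.emit x y :: l)) (t + 1) Q σ := by
  subst ha hb
  exact Wp.cons (t₁ := 1) (R := fun σ' => σ' = σ.append (σ.reg x) (σ.reg y))
    ⟨1, le_rfl, _, .emit, rfl⟩ (fun _ e => e ▸ h) (by omega)

lemma Wp.ifLt (hp : σ.reg x < σ.reg y → Wp d W S p t Q σ)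
    (hq : ¬ σ.reg x < σ.reg y → Wp d W S q t Q σ) : Wp d W S (.ifLt x y p q) (t + 1) Q σ := by
  by_cases h : σ.reg x < σ.reg y
  · obtain ⟨t', ht', σ', he, hQ⟩ := hp h
    exact ⟨t' + 1, by omega, σ', .ifLt_true h he, hQ⟩
  · obtain ⟨t', ht', σ', he, hQ⟩ := hq h
    exact ⟨t' + 1, by omega, σ', .ifLt_false h he, hQ⟩

lemma Wp.ifDistLe {a b c e : ℕ} (i j k o : Fin n) (ha : σ.reg a = i) (hb : σ.reg b = j)
    (hc : σ.reg c = k) (he : σ.reg e = o)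
    (hp : d s(i, j) ≤ d s(k, o) → Wp d W S p t Q σ)
    (hq : ¬ d s(i, j) ≤ d s(k, o) → Wp d W S q t Q σ) :
    Wp d W S (.ifDistLe a b c e p q) (t + 1) Q σ := by
  by_cases h : d s(i, j) ≤ d s(k, o)
  · obtain ⟨t', ht', σ', hx, hQ⟩ := hp h
    exact ⟨t' + 1, by omega, σ', .ifDistLe_true ha hb hc he h hx, hQ⟩
  · obtain ⟨t', ht', σ', hx, hQ⟩ := hq h
    exact ⟨t' + 1, by omega, σ', .ifDistLe_false ha hb hc he h hx, hQ⟩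

/-- A loop whose body takes at most `c` steps and decreases the variant `m`. -/
lemma Wp.whileLt {Inv : ℕ → State → Prop} {c : ℕ}
    (hbody : ∀ m σ, Inv m σ → σ.reg x < σ.reg y →
      Wp d W S p c (fun σ' => ∃ m' < m, Inv m' σ') σ) (h : Inv m σ) :
    Wp d W S (.whileLt x y p) (m * (c + 1) + 1)
      (fun σ' => (∃ m', Inv m' σ') ∧ ¬ σ'.reg x < σ'.reg y) σ := by
  induction m using Nat.strong_induction_on generalizing σ with
  | _ m ih =>
    by_cases hlt : σ.reg x < σ.reg y
    · obtain ⟨t', ht', σ', he, m', hm', hI⟩ := hbody m σ h hlt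
      obtain ⟨t'', ht'', σ'', he', hQ⟩ := ih m' hm' hI
      refine ⟨t' + t'' + 1, ?_, σ'', .while_true hlt he he', hQ⟩
      have : (m' + 1) * (c + 1) ≤ m * (c + 1) := Nat.mul_le_mul_right _ hm'
      rw [add_mul] at this
      omega
    · exact ⟨1, by omega, σ, .while_false hlt, ⟨m, h⟩, hlt⟩

/-- A loop that counts the register `x` up to the value `b` of the register `y`. -/
lemma Wp.forLt {Inv : ℕ → State → Prop} {b c : ℕ}
    (hreg : ∀ j σ, Inv j σ → σ.reg x = j ∧ σ.reg y = b ∧ j ≤ b)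
    (hbody : ∀ j σ, j < b → Inv j σ → Wp d W S p c (Inv (j + 1)) σ) (h : Inv 0 σ) :
    Wp d W S (.whileLt x y p) (b * (c + 1) + 1) (Inv b) σ := by
  -- The variant is the number of iterations that remain.
  have := Wp.whileLt (d := d) (W := W) (S := S) (x := x) (y := y) (p := p) (c := c) (m := b) (σ := σ)
    (Inv := fun m σ => m ≤ b ∧ Inv (b - m) σ) ?_ ⟨le_rfl, by simpa using h⟩
  · refine this.mono le_rfl ?_
    rintro σ' ⟨⟨m, hm, hI⟩, hlt⟩
    obtain ⟨h₁, h₂, h₃⟩ := hreg _ _ hI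
    have : b - m = b := by omega
    rwa [this] at hI
  · rintro m σ ⟨hm, hI⟩ hlt
    obtain ⟨h₁, h₂, h₃⟩ := hreg _ _ hI
    refine (hbody (b - m) σ (by omega) hI).mono le_rfl fun σ' h' => ⟨m - 1, by omega, by omega, ?_⟩
    have : b - (m - 1) = b - m + 1 := by omega
    rwa [this]

end Wp

/-- The states agree except in the listed registers. -/
structure SameExcept (l : List ℕ) (σ σ' : State) : Prop where
  reg : ∀ i, i ∉ l → σ'.reg i = σ.reg i
  mem : σ'.mem = σ.mem
  out : σ'.out = σ.out

lemma SameExcept.refl (l : List ℕ) (σ : State) : SameExcept l σ σ := ⟨fun _ _ => rfl, rfl, rfl⟩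

lemma SameExcept.trans {l₁ l₂ l : List ℕ} {σ σ' σ'' : State} (h₁ : SameExcept l₁ σ σ')
    (h₂ : SameExcept l₂ σ' σ'') (hl₁ : l₁ ⊆ l) (hl₂ : l₂ ⊆ l) : SameExcept l σ σ'' :=
  ⟨fun i hi => (h₂.reg i fun h => hi (hl₂ h)).trans (h₁.reg i fun h => hi (hl₁ h)),
    h₂.mem.trans h₁.mem, h₂.out.trans h₁.out⟩

lemma SameExcept.setReg {l : List ℕ} {σ σ' : State} (h : SameExcept l σ σ') {x v : ℕ}
    (hx : x ∈ l) : SameExcept l σ (σ'.setReg x v) := by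
  refine ⟨fun i hi => ?_, h.mem, h.out⟩
  have hne : i ≠ x := fun e => hi (by rwa [e])
  rw [State.setReg_reg, if_neg hne, h.reg i hi]

/-! ### Keeping the shortest candidate in registers. -/

section Best

variable {n : ℕ} {D : Type*} [LinearOrder D] {d : Sym2 (Fin n) → D} {W S : ℕ} {σ : State}
  {old : Option (Fin n × Fin n)} {C : Set (Fin n × Fin n × ℕ)}

/-- The registers `7`, `8` hold a shortest edge among `old` and the set `C` of candidates; the
register `6` tells whether there is none (`0`), or it is `old` (`1`), or it is strictly shorter than
`old` (`2`), and then register `9` holds its label. -/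
inductive IsBest (d : Sym2 (Fin n) → D) (old : Option (Fin n × Fin n))
    (C : Set (Fin n × Fin n × ℕ)) (σ : State) : Prop
  | none (h6 : σ.reg 6 = 0) (ho : old = none) (hC : C = ∅)
  | old {o : Fin n × Fin n} (h6 : σ.reg 6 = 1) (ho : old = some o) (h7 : σ.reg 7 = o.1)
      (h8 : σ.reg 8 = o.2) (hC : ∀ c ∈ C, d (pairEdge o) ≤ d s(c.1, c.2.1))
  | new {b : Fin n × Fin n × ℕ} (h6 : σ.reg 6 = 2) (hb : b ∈ C) (h7 : σ.reg 7 = b.1)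
      (h8 : σ.reg 8 = b.2.1) (h9 : σ.reg 9 = b.2.2)
      (hC : ∀ c ∈ C, d s(b.1, b.2.1) ≤ d s(c.1, c.2.1))
      (ho : ∀ o ∈ old, d s(b.1, b.2.1) < d (pairEdge o))

lemma IsBest.congr {σ' : State} (h : IsBest d old C σ)
    (h6 : σ'.reg 6 = σ.reg 6) (h7 : σ'.reg 7 = σ.reg 7) (h8 : σ'.reg 8 = σ.reg 8)
    (h9 : σ'.reg 9 = σ.reg 9) : IsBest d old C σ' := by
  cases h with
  | none a b c => exact .none (h6.trans a) b c
  | old a b c e f => exact .old (h6.trans a) b (h7.trans c) (h8.trans e) f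
  | new a b c e f g k => exact .new (h6.trans a) b (h7.trans c) (h8.trans e) (h9.trans f) g k

/-- `x := y`, where register `1` holds `0`. -/
def copy (x y : ℕ) : Program := .arith .add x y 1

lemma Wp.copy {l : List Program} {t x y : ℕ} {Q : State → Prop} (v : ℕ) (hv : σ.reg y = v)
    (h1 : σ.reg 1 = 0) (hW : v < W) (h : Wp d W S (block l) t Q (σ.setReg x v)) :
    Wp d W S (block (MultipleFragment.copy x y :: l)) (t + 1) Q σ :=
  Wp.arith v (by simp [ArithOp.eval, hv, h1]) hW h

/-- Make the pair in the registers `a`, `b` with label `c` the best edge. -/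
def setBest (a b c : ℕ) : Program := block [copy 7 a, copy 8 b, copy 9 c, .const 6 2]

/-- Consider the pair in the registers `a`, `b` with label `c` as a candidate. -/
def consider (a b c : ℕ) : Program :=
  .ifLt 6 2 (setBest a b c) (.ifDistLe 7 8 a b .skip (setBest a b c))

lemma wp_setBest {a b c w : ℕ} {u v : Fin n} (hn : n ≤ W) (hw : w < W) (h2 : 2 < W)
    (h1 : σ.reg 1 = 0) (ha : σ.reg a = u) (hb : σ.reg b = v) (hc : σ.reg c = w)
    (hb' : b ≠ 7) (hc' : c ≠ 7) (hc'' : c ≠ 8) :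
    Wp d W S (setBest a b c) 5 (fun σ' => SameExcept [6, 7, 8, 9] σ σ' ∧
      σ'.reg 6 = 2 ∧ σ'.reg 7 = u ∧ σ'.reg 8 = v ∧ σ'.reg 9 = w) σ := by
  refine Wp.copy u ha h1 (u.2.trans_le hn) ?_
  refine Wp.copy v (by simp [hb, hb']) (by simpa using h1) (v.2.trans_le hn) ?_
  refine Wp.copy w (by simp [hc, hc', hc'']) (by simpa using h1) hw ?_
  refine Wp.const h2 (Wp.nil ⟨?_, by simp⟩)
  exact ((((SameExcept.refl _ _).setReg (by simp)).setReg (by simp)).setReg (by simp)).setReg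
    (by simp)

/-- A candidate replaces the current edge only if it is strictly shorter. Ties are thus resolved in
favor of `old`, which makes the chain strictly decreasing. -/
lemma wp_consider {a b c w : ℕ} {u v : Fin n} (hn : n ≤ W) (hw : w < W) (h2W : 2 < W)
    (hbest : IsBest d old C σ) (h1 : σ.reg 1 = 0) (h2 : σ.reg 2 = 1) (ha : σ.reg a = u)
    (hb : σ.reg b = v) (hc : σ.reg c = w) (hb' : b ≠ 7) (hc' : c ≠ 7) (hc'' : c ≠ 8) :
    Wp d W S (consider a b c) 7 (fun σ' => SameExcept [6, 7, 8, 9] σ σ' ∧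
      IsBest d old (insert (u, v, w) C) σ') σ := by
  have hset : ∀ t, 5 ≤ t → (∀ c ∈ C, d s(u, v) ≤ d s(c.1, c.2.1)) →
      (∀ o ∈ old, d s(u, v) < d (pairEdge o)) →
      Wp d W S (setBest a b c) t (fun σ' => SameExcept [6, 7, 8, 9] σ σ' ∧
      IsBest d old (insert (u, v, w) C) σ') σ := by
    intro t ht hC ho
    refine (wp_setBest hn hw h2W h1 ha hb hc hb' hc' hc'').mono ht ?_
    rintro σ' ⟨hs, h6, h7, h8, h9⟩
    refine ⟨hs, .new h6 (Set.mem_insert _ _) h7 h8 h9 ?_ ho⟩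
    rintro c (rfl | hc)
    · exact le_rfl
    · exact hC c hc
  refine Wp.ifLt (fun hlt => ?_) (fun hlt => ?_)
  · cases hbest with
    | none h6 ho hC => exact hset _ (by omega) (by simp [hC]) (by simp [ho])
    | old h6 => omega
    | new h6 => omega
  · cases hbest with
    | none h6 => omega
    | @old o h6 ho h7 h8 hC =>
      refine Wp.ifDistLe o.1 o.2 u v h7 h8 ha hb (fun hle => Wp.skip ⟨.refl _ _, ?_⟩)
        (fun hle => hset _ (by omega) ?_ ?_)
      · refine .old h6 ho h7 h8 ?_
        rintro c (rfl | hc)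
        · exact hle
        · exact hC c hc
      · exact fun c hc => (not_le.1 hle).le.trans (hC c hc)
      · rintro o' ho'
        rw [ho] at ho'
        cases ho'
        exact not_le.1 hle
    | @new e h6 he h7 h8 h9 hC ho =>
      refine Wp.ifDistLe e.1 e.2.1 u v h7 h8 ha hb (fun hle => Wp.skip ⟨.refl _ _, ?_⟩)
        (fun hle => hset _ (by omega) ?_ ?_)
      · refine .new h6 (Set.mem_insert_of_mem _ he) h7 h8 h9 ?_ ho
        rintro c (rfl | hc)
        · exact hle
        · exact hC c hc
      · exact fun c hc => (not_le.1 hle).le.trans (hC c hc)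
      · exact fun o ho' => (not_le.1 hle).trans (ho o ho')

end Best

/-! ### Arrays of pairs in the memory. -/

section ArrAt

variable {n b₁ b₂ : ℕ} {m m' : ℕ → ℕ} {L L' : List (Fin n × Fin n)} {p : Fin n × Fin n}

/-- The memory contains the list `L` of pairs in two arrays that start at `b₁` and `b₂`. -/
def ArrAt (m : ℕ → ℕ) (b₁ b₂ : ℕ) (L : List (Fin n × Fin n)) : Prop :=
  ∀ i p, L[i]? = some p → m (b₁ + i) = p.1 ∧ m (b₂ + i) = p.2

lemma ArrAt.congr (h : ArrAt m b₁ b₂ L)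
    (he : ∀ i < L.length, m' (b₁ + i) = m (b₁ + i) ∧ m' (b₂ + i) = m (b₂ + i)) :
    ArrAt m' b₁ b₂ L := by
  intro i p hp
  obtain ⟨hi, -⟩ := List.getElem?_eq_some_iff.1 hp
  rw [(he i hi).1, (he i hi).2]
  exact h i p hp

lemma ArrAt.of_append (h : ArrAt m b₁ b₂ (L ++ L')) : ArrAt m b₁ b₂ L := by
  intro i p hp
  obtain ⟨hi, -⟩ := List.getElem?_eq_some_iff.1 hp
  exact h i p (by rw [List.getElem?_append_left hi, hp])

lemma ArrAt.concat (h : ArrAt m b₁ b₂ L) (h₁ : m' (b₁ + L.length) = p.1)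
    (h₂ : m' (b₂ + L.length) = p.2)
    (he : ∀ i < L.length, m' (b₁ + i) = m (b₁ + i) ∧ m' (b₂ + i) = m (b₂ + i)) :
    ArrAt m' b₁ b₂ (L ++ [p]) := by
  intro i q hq
  by_cases hi : i < L.length
  · rw [List.getElem?_append_left hi] at hq
    exact h.congr he i q hq
  · obtain ⟨hi', -⟩ := List.getElem?_eq_some_iff.1 hq
    rw [List.length_append, List.length_singleton] at hi'
    obtain rfl : i = L.length := by omega
    rw [List.getElem?_concat_length] at hq
    cases hq
    exact ⟨h₁, h₂⟩

end ArrAt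

/-- Registers: `0` the number `n` of sites; `1`, `2`, `19` the constants `0`, `1`, `2`; `15`, `16`,
`17` the addresses `2 * n`, `3 * n`, `4 * n`. -/
structure HasConsts (n : ℕ) (σ : State) : Prop where
  r0 : σ.reg 0 = n
  r1 : σ.reg 1 = 0
  r2 : σ.reg 2 = 1
  r19 : σ.reg 19 = 2
  r15 : σ.reg 15 = 2 * n
  r16 : σ.reg 16 = 3 * n
  r17 : σ.reg 17 = 4 * n

lemma HasConsts.congr {n : ℕ} {l : List ℕ} {σ σ' : State} (h : HasConsts n σ)
    (hs : SameExcept l σ σ') (hl : ∀ i ∈ [0, 1, 2, 19, 15, 16, 17], i ∉ l) : HasConsts n σ' := by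
  obtain ⟨h0, h1, h2, h19, h15, h16, h17⟩ := h
  constructor <;> rw [hs.reg _ (hl _ (by simp))] <;> assumption

/-! ### The scan for a shortest exit of a fragment. -/

section Chain

variable {n : ℕ} {D : Type*} [LinearOrder D] {d : Sym2 (Fin n) → D} {W S : ℕ} {σ σ' : State}
  {E K : List (Fin n × Fin n)} {P : Finset (Fin n)} {mate : Fin n → Fin n} {r x : Fin n}
  {old : Option (Fin n × Fin n)} {C : Set (Fin n × Fin n × ℕ)}

/-- The contents of the memory cells below `n`: the mates of the endpoints, `n` for other sites. -/
def HasMates (m : ℕ → ℕ) (P : Finset (Fin n)) (mate : Fin n → Fin n) : Prop :=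
  ∀ v : Fin n, m v = if v ∈ P then (mate v : ℕ) else n

/-- The state of the machine with the included edges `E`, the chain `K`, and an endpoint `r`. -/
structure IsChainState (d : Sym2 (Fin n) → D) (E K : List (Fin n × Fin n)) (P : Finset (Fin n))
    (mate : Fin n → Fin n) (r : Fin n) (σ : State) : Prop where
  consts : HasConsts n σ
  r3 : σ.reg 3 = K.length
  r4 : σ.reg 4 = E.length
  r5 : σ.reg 5 = r
  out : σ.out = []
  mates : HasMates σ.mem P mate
  links : ArrAt σ.mem n (2 * n) K.reverse
  edges : ArrAt σ.mem (3 * n) (4 * n) E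
  rep : Represents (E.map pairEdge) P mate
  inv : LocalInv d (E.map pairEdge)
  chain : IsNeighborChain d P mate K
  mem : r ∈ P

lemma IsChainState.congr {l : List ℕ} (h : IsChainState d E K P mate r σ)
    (hs : SameExcept l σ σ') (hl : ∀ i ∈ [0, 1, 2, 3, 4, 5, 15, 16, 17, 19], i ∉ l) :
    IsChainState d E K P mate r σ' := by
  refine ⟨h.consts.congr hs fun i hi => hl i ((by decide :
    [0, 1, 2, 19, 15, 16, 17] ⊆ [0, 1, 2, 3, 4, 5, 15, 16, 17, 19]) hi), ?_, ?_, ?_, ?_, ?_, ?_, ?_, h.rep,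
    h.inv, h.chain, h.mem⟩
  · rw [hs.reg _ (hl _ (by simp)), h.r3]
  · rw [hs.reg _ (hl _ (by simp)), h.r4]
  · rw [hs.reg _ (hl _ (by simp)), h.r5]
  · rw [hs.out, h.out]
  · rw [hs.mem]; exact h.mates
  · rw [hs.mem]; exact h.links
  · rw [hs.mem]; exact h.edges

lemma IsChainState.length_edges (h : IsChainState d E K P mate r σ) : E.length ≤ n := by
  simpa using h.rep.length_le

lemma IsChainState.edges_lt (h : IsChainState d E K P mate r σ) {p : Fin n × Fin n}
    (hj : Joins (E.map pairEdge) (pairEdge p)) : E.length < n := by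
  have := (h.rep.append hj).length_le
  simp only [List.length_append, List.length_map, List.length_singleton] at this
  omega

/-- Compare the candidates that end in the site in register `12`. -/
def scanBody : Program := block
  [.load 13 12,
    .ifLt 13 0 (.ifLt 12 10 (.ifLt 12 11 (block [consider 10 12 12, consider 11 12 12])
        (.ifLt 11 12 (block [consider 10 12 12, consider 11 12 12]) .skip))
      (.ifLt 10 12 (.ifLt 12 11 (block [consider 10 12 12, consider 11 12 12])
        (.ifLt 11 12 (block [consider 10 12 12, consider 11 12 12]) .skip)) .skip)) .skip,
    .arith .add 12 12 2]

/-- Find a shortest edge that leaves the fragment of the site in register `10`. -/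
def findShortest : Program := block [.const 12 0, .whileLt 12 0 scanBody]

/-- The candidates for the scan, restricted to those that end before `j`. -/
def candidates (P : Finset (Fin n)) (mate : Fin n → Fin n) (x : Fin n) (j : ℕ) :
    Set (Fin n × Fin n × ℕ) :=
  {c | Leaves P mate x (c.1, c.2.1) ∧ (c.2.1 : ℕ) < j ∧ c.2.2 = c.2.1}

lemma candidates_succ_of_not {j : Fin n} (h : ¬ (j ∈ P ∧ j ≠ x ∧ j ≠ mate x)) :
    candidates P mate x (j + 1) = candidates P mate x j := by
  ext ⟨u, v, w⟩
  simp only [candidates, Leaves, Set.mem_ofPred_eq]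
  constructor
  · rintro ⟨h₁, h₂, h₃⟩
    refine ⟨h₁, ?_, h₃⟩
    rcases Nat.lt_succ_iff_lt_or_eq.1 h₂ with h₂ | h₂
    · exact h₂
    · obtain rfl := Fin.ext h₂
      exact absurd h₁.2 h
  · rintro ⟨h₁, h₂, h₃⟩
    exact ⟨h₁, by omega, h₃⟩

lemma candidates_succ {j : Fin n} (h : j ∈ P ∧ j ≠ x ∧ j ≠ mate x) :
    candidates P mate x (j + 1) =
      insert (mate x, j, (j : ℕ)) (insert (x, j, (j : ℕ)) (candidates P mate x j)) := by
  ext ⟨u, v, w⟩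
  simp only [candidates, Leaves, Set.mem_ofPred_eq, Set.mem_insert_iff, Prod.mk.injEq]
  constructor
  · rintro ⟨h₁, h₂, h₃⟩
    rcases Nat.lt_succ_iff_lt_or_eq.1 h₂ with h₂ | h₂
    · exact Or.inr (Or.inr ⟨h₁, h₂, h₃⟩)
    · obtain rfl := Fin.ext h₂
      rcases h₁.1 with rfl | rfl
      · exact Or.inr (Or.inl ⟨rfl, rfl, h₃⟩)
      · exact Or.inl ⟨rfl, rfl, h₃⟩
  · rintro (⟨rfl, rfl, rfl⟩ | ⟨rfl, rfl, rfl⟩ | ⟨h₁, h₂, h₃⟩)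
    · exact ⟨⟨Or.inr rfl, h⟩, by omega, rfl⟩
    · exact ⟨⟨Or.inl rfl, h⟩, by omega, rfl⟩
    · exact ⟨h₁, by omega, h₃⟩

lemma wp_scanBody (hW : 5 * n + 5 ≤ W) (hS : 5 * n ≤ S) {j : ℕ} (hj : j < n)
    (hc : HasConsts n σ) (hm : HasMates σ.mem P mate) (hx : σ.reg 10 = x)
    (hmx : σ.reg 11 = mate x) (h12 : σ.reg 12 = j)
    (hb : IsBest d old (candidates P mate x j) σ) :
    Wp d W S scanBody 24 (fun σ' => SameExcept [6, 7, 8, 9, 12, 13] σ σ' ∧ σ'.reg 12 = j + 1 ∧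
      IsBest d old (candidates P mate x (j + 1)) σ') σ := by
  obtain ⟨j, rfl⟩ : ∃ i : Fin n, (i : ℕ) = j := ⟨⟨j, hj⟩, rfl⟩
  refine Wp.load j _ h12 (by omega) (hm j) ?_
  set σ₁ := σ.setReg 13 (if j ∈ P then (mate j : ℕ) else n) with hσ₁
  have hs₁ : SameExcept [6, 7, 8, 9, 13] σ σ₁ := (SameExcept.refl _ _).setReg (by simp)
  have hb₁ : IsBest d old (candidates P mate x j) σ₁ :=
    hb.congr (by simp [hσ₁]) (by simp [hσ₁]) (by simp [hσ₁]) (by simp [hσ₁])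
  have r0 : σ₁.reg 0 = n := by simp [hσ₁, hc.r0]
  have r1 : σ₁.reg 1 = 0 := by simp [hσ₁, hc.r1]
  have r2 : σ₁.reg 2 = 1 := by simp [hσ₁, hc.r2]
  have r10 : σ₁.reg 10 = x := by simp [hσ₁, hx]
  have r11 : σ₁.reg 11 = mate x := by simp [hσ₁, hmx]
  have r12 : σ₁.reg 12 = j := by simp [hσ₁, h12]
  have r13 : σ₁.reg 13 = if j ∈ P then (mate j : ℕ) else n := by simp [hσ₁]
  let Q : State → Prop := fun σ' => SameExcept [6, 7, 8, 9, 13] σ σ' ∧ σ'.reg 12 = j ∧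
    IsBest d old (candidates P mate x (j + 1)) σ'
  have hskip : ∀ t, ¬ (j ∈ P ∧ j ≠ x ∧ j ≠ mate x) → Wp d W S .skip (t + 1) Q σ₁ := fun t h =>
    Wp.skip ⟨hs₁, r12, by rw [candidates_succ_of_not h]; exact hb₁⟩
  have hcons : ∀ t, j ∈ P ∧ j ≠ x ∧ j ≠ mate x →
      Wp d W S (block [consider 10 12 12, consider 11 12 12]) (t + 15) Q σ₁ := by
    intro t h
    refine Wp.cons (t₂ := 8) (wp_consider (by omega) (w := (j : ℕ)) (by omega) (by omega) hb₁ r1 r2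
      r10 r12 r12 (by simp) (by simp) (by simp)) ?_ (by omega)
    rintro σ₂ ⟨hs₂, hb₂⟩
    refine Wp.cons (t₂ := 1) (wp_consider (by omega) (w := (j : ℕ)) (by omega) (by omega) hb₂
      ((hs₂.reg _ (by simp)).trans r1) ((hs₂.reg _ (by simp)).trans r2)
      ((hs₂.reg _ (by simp)).trans r11) ((hs₂.reg _ (by simp)).trans r12)
      ((hs₂.reg _ (by simp)).trans r12) (by simp) (by simp) (by simp)) ?_ (by omega)
    rintro σ₃ ⟨hs₃, hb₃⟩
    refine Wp.nil ⟨?_, ?_, ?_⟩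
    · exact (hs₁.trans hs₂ (List.Subset.refl _) (by simp)).trans hs₃ (List.Subset.refl _) (by simp)
    · rw [hs₃.reg _ (by simp), hs₂.reg _ (by simp), r12]
    · rw [candidates_succ h]
      exact hb₃
  refine Wp.cons (R := Q) (t₁ := 20) (t₂ := 2) ?_ ?_ (by omega)
  · refine Wp.ifLt (fun h13 => ?_) (fun h13 => hskip _ fun h => ?_)
    -- Mates are less than `n`, and other sites are marked by `n`, so the test recognizes endpoints.
    · have hjP : j ∈ P := by
        by_contra hjP
        rw [r13, r0, if_neg hjP] at h13
        omega
      -- The machine tests only `<`; two tests decide an inequality of sites.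
      have hne : ∀ y : Fin n, j ≠ y ↔ ((j : ℕ) < y ∨ (y : ℕ) < j) := fun y => by
        rw [← lt_or_lt_iff_ne]; rfl
      have key : ∀ t, j ≠ x → Wp d W S
          (.ifLt 12 11 (block [consider 10 12 12, consider 11 12 12])
          (.ifLt 11 12 (block [consider 10 12 12, consider 11 12 12]) .skip)) (t + 17) Q σ₁ := by
        intro t hjx
        refine Wp.ifLt (fun h => hcons _ ⟨hjP, hjx, ?_⟩) (fun h => Wp.ifLt
          (fun h' => hcons _ ⟨hjP, hjx, ?_⟩) (fun h' => hskip _ ?_))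
        all_goals
          rw [r11, r12] at *
          have := hne (mate x)
          tauto
      refine Wp.ifLt (fun h => key _ ?_) (fun h => Wp.ifLt (fun h' => key _ ?_)
        (fun h' => hskip _ ?_))
      all_goals
        rw [r10, r12] at *
        have := hne x
        tauto
    · rw [r13, r0, if_pos h.1] at h13
      exact h13 (mate j).2
  · rintro σ₂ ⟨hs₂, h12₂, hb₂⟩
    refine Wp.arith (j + 1) ?_ (by omega) (Wp.nil ⟨?_, by simp, ?_⟩)
    · rw [h12₂, hs₂.reg _ (by simp), hc.r2]
      rfl
    · exact (hs₂.trans (SameExcept.refl [] _) (l := [6, 7, 8, 9, 12, 13]) (by simp)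
        (by simp)).setReg (by simp)
    · exact hb₂.congr (by simp) (by simp) (by simp) (by simp)

lemma wp_scan (hW : 5 * n + 5 ≤ W) (hS : 5 * n ≤ S)
    (hc : HasConsts n σ) (hm : HasMates σ.mem P mate) (hx : σ.reg 10 = x)
    (hmx : σ.reg 11 = mate x) (hb : IsBest d old ∅ σ) :
    Wp d W S findShortest (n * 25 + 3) (fun σ' => SameExcept [6, 7, 8, 9, 12, 13] σ σ' ∧
      IsBest d old (candidates P mate x n) σ') σ := by
  refine Wp.const (by omega) ?_
  refine Wp.cons (t₂ := 1) (Wp.forLt (c := 24) (b := n) (Inv := fun j σ' =>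
    SameExcept [6, 7, 8, 9, 12, 13] σ σ' ∧ σ'.reg 12 = j ∧ j ≤ n ∧
      IsBest d old (candidates P mate x j) σ') ?_ ?_ ?_) ?_ le_rfl
  · rintro j σ' ⟨hs, h12, hj, -⟩
    exact ⟨h12, by rw [hs.reg _ (by simp), hc.r0], hj⟩
  · rintro j σ' hj ⟨hs, h12, -, hb⟩
    refine (wp_scanBody hW hS hj (hc.congr hs (by decide)) (by rw [hs.mem]; exact hm)
      (by rw [hs.reg _ (by simp), hx]) (by rw [hs.reg _ (by simp), hmx]) h12 hb).mono le_rfl ?_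
    rintro σ'' ⟨hs', h12', hb'⟩
    exact ⟨hs.trans hs' (List.Subset.refl _) (List.Subset.refl _), h12', hj, hb'⟩
  · refine ⟨(SameExcept.refl _ _).setReg (by simp), by simp, by omega, ?_⟩
    have : candidates P mate x 0 = ∅ := by
      ext
      simp [candidates]
    rw [this]
    exact hb.congr (by simp) (by simp) (by simp) (by simp)
  · rintro σ' ⟨hs, -, -, hb⟩
    exact Wp.nil ⟨hs, hb⟩

end Chain

/-! ### The main loop: extending the chain or merging at its end. -/

section Loop

variable {n : ℕ} {D : Type*} [LinearOrder D] {d : Sym2 (Fin n) → D} {W S : ℕ} {σ σ' : State}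
  {E K : List (Fin n × Fin n)} {P : Finset (Fin n)} {mate : Fin n → Fin n} {r x : Fin n}
  {p : Fin n × Fin n}

/-- Start from the last link of the chain, or from the endpoint in register `5` if there is none. -/
def loadTop : Program :=
  .ifLt 1 3 (block [.arith .sub 14 3 2, .arith .add 18 0 14, .load 7 18, .arith .add 18 15 14,
    .load 8 18, copy 10 8, .const 6 1]) (block [copy 10 5, .const 6 0])

/-- Extend the chain by the best edge. -/
def pushLink : Program := block [.arith .add 18 0 3, .store 18 7, .arith .add 18 15 3, .store 18 8,
  .arith .add 3 3 2]

/-- Include the best edge, and remove two links from the chain. -/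
def mergeTop : Program := block [.arith .add 18 16 4, .store 18 7, .arith .add 18 17 4, .store 18 8,
  .arith .add 4 4 2, .arith .sub 3 3 19, .load 13 7, .load 14 8, .store 7 0, .store 8 0,
  .store 13 14, .store 14 13, copy 5 13]

/-- One step of the nearest-neighbor chain algorithm. -/
def chainBody : Program := block [loadTop, .load 11 10, findShortest,
  .ifLt 6 2 .skip (.ifLt 6 19 mergeTop pushLink)]

lemma wp_loadTop (hW : 5 * n + 5 ≤ W) (hS : 5 * n ≤ S) (h : IsChainState d E K P mate r σ) :
    Wp d W S loadTop 9 (fun σ' => SameExcept [6, 7, 8, 10, 14, 18] σ σ' ∧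
      IsBest d K.head? ∅ σ' ∧ ∃ x ∈ P, σ'.reg 10 = x ∧ (∀ q ∈ K.head?, x = q.2) ∧
        (K = [] → x = r)) σ := by
  have hc := h.consts
  have hlen := h.chain.length_le
  refine Wp.ifLt (fun hlt => ?_) (fun hlt => ?_)
  · rw [hc.r1, h.r3] at hlt
    cases K with
    | nil => simp at hlt
    | cons p K =>
      have hK : σ.reg 3 = K.length + 1 := h.r3
      rw [List.length_cons] at hlen
      have hp := h.links K.length p (by
        rw [List.reverse_cons, ← List.length_reverse, List.getElem?_concat_length])
      refine Wp.arith K.length (by simp [ArithOp.eval, hK, hc.r2]) (by omega) ?_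
      refine Wp.arith (n + K.length) (by simp [ArithOp.eval, hc.r0]) (by omega) ?_
      refine Wp.load (n + K.length) p.1 (by simp) (by omega) (by simpa using hp.1) ?_
      refine Wp.arith (2 * n + K.length) (by simp [ArithOp.eval, hc.r15]) (by omega) ?_
      refine Wp.load (2 * n + K.length) p.2 (by simp) (by omega) (by simpa using hp.2) ?_
      refine Wp.copy p.2 (by simp) (by simp [hc.r1]) (by omega) ?_
      refine Wp.const (by omega) (Wp.nil ⟨?_, ?_, p.2, (h.chain.shortest p (by simp)).2.1.2.1,
        by simp, by simp, by simp⟩)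
      · refine SameExcept.setReg (SameExcept.setReg (SameExcept.setReg (SameExcept.setReg
          (SameExcept.setReg (SameExcept.setReg (SameExcept.setReg (SameExcept.refl _ _)
          ?_) ?_) ?_) ?_) ?_) ?_) ?_ <;> simp
      · exact .old (o := p) (by simp) (by simp) (by simp) (by simp) (by simp)
  · rw [hc.r1, h.r3] at hlt
    have hK : K = [] := List.length_eq_zero_iff.1 (by omega)
    subst hK
    refine Wp.copy r h.r5 hc.r1 (by omega) ?_
    refine Wp.const (by omega) (Wp.nil ⟨?_, ?_, r, h.mem, by simp, by simp, by simp⟩)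
    · refine SameExcept.setReg (SameExcept.setReg (SameExcept.refl _ _) ?_) ?_ <;> simp
    · exact .none (by simp) rfl rfl

lemma wp_pushLink (hW : 5 * n + 5 ≤ W) (hS : 5 * n ≤ S) (h : IsChainState d E K P mate r σ)
    (h7 : σ.reg 7 = p.1) (h8 : σ.reg 8 = p.2) (hp : IsNeighborChain d P mate (p :: K)) :
    Wp d W S pushLink 6
      (fun σ' => σ'.reg 6 = σ.reg 6 ∧ IsChainState d E (p :: K) P mate r σ') σ := by
  have hc := h.consts
  have hlen := hp.length_le
  rw [List.length_cons] at hlen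
  have hE := h.length_edges
  refine Wp.arith (n + K.length) (by simp [ArithOp.eval, hc.r0, h.r3]) (by omega) ?_
  refine Wp.store (n + K.length) p.1 (by simp) (by omega) (by simp [h7]) ?_
  refine Wp.arith (2 * n + K.length) (by simp [ArithOp.eval, hc.r15, h.r3]) (by omega) ?_
  refine Wp.store (2 * n + K.length) p.2 (by simp) (by omega) (by simp [h8]) ?_
  refine Wp.arith (K.length + 1) (by simp [ArithOp.eval, hc.r2, h.r3]) (by omega) ?_
  refine Wp.nil ⟨by simp, ?_⟩
  refine ⟨⟨?_, ?_, ?_, ?_, ?_, ?_, ?_⟩, ?_, ?_, ?_, ?_, ?_, ?_, ?_, h.rep, h.inv, hp, h.mem⟩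
  · simp [hc.r0]
  · simp [hc.r1]
  · simp [hc.r2]
  · simp [hc.r19]
  · simp [hc.r15]
  · simp [hc.r16]
  · simp [hc.r17]
  · simp
  · simp [h.r4]
  · simp [h.r5]
  · simp [h.out]
  -- The two cells written lie in the arrays of the chain, above the cells of the mates.
  · intro v
    have := v.2
    have := h.mates v
    simp only [State.setReg_mem, State.setMem_mem]
    rw [if_neg (by omega), if_neg (by omega), this]
  · rw [List.reverse_cons]
    refine h.links.concat ?_ ?_ fun i hi => ?_
    · simp only [State.setReg_mem, State.setMem_mem, List.length_reverse]
      rw [if_neg (by omega), if_pos trivial]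
    · simp only [State.setReg_mem, State.setMem_mem, List.length_reverse]
      rw [if_pos trivial]
    · rw [List.length_reverse] at hi
      simp only [State.setReg_mem, State.setMem_mem]
      rw [if_neg (by omega), if_neg (by omega), if_neg (by omega), if_neg (by omega)]
      exact ⟨rfl, rfl⟩
  · refine h.edges.congr fun i hi => ?_
    simp only [State.setReg_mem, State.setMem_mem]
    rw [if_neg (by omega), if_neg (by omega), if_neg (by omega), if_neg (by omega)]
    exact ⟨rfl, rfl⟩

/-- The nested conditions list the four writes from last to first. The new mates are written after
the marks `n`, so the end of a trivial fragment, which is its own mate, correctly remains an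
endpoint. -/
lemma HasMates.merge {m m' : ℕ → ℕ} (h : HasMates m P mate)
    (hF : Represents (E.map pairEdge) P mate) (hj : Joins (E.map pairEdge) (pairEdge p))
    (hm' : ∀ v : Fin n, m' v = if v = mate p.2 then (mate p.1 : ℕ) else
      if v = mate p.1 then (mate p.2 : ℕ) else if v = p.2 then n else if v = p.1 then n else m v) :
    HasMates m' (nextEnds P mate p.1 p.2) (nextMate mate p.1 p.2) := by
  obtain ⟨h₁, h₂, h₃, h₄⟩ := hF.joins_iff.1 hj
  have hm₁ := hF.mate_mem _ h₁
  have hm₂ := hF.mate_mem _ h₂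
  have hmm₁ := hF.mate_mate _ h₁
  have hmm₂ := hF.mate_mate _ h₂
  intro v
  rw [hm', h v]
  simp only [nextEnds, nextMate, Finset.mem_filter, Function.update_apply]
  grind

lemma wp_mergeTop (hW : 5 * n + 5 ≤ W) (hS : 5 * n ≤ S)
    (h : IsChainState d E (p :: K) P mate r σ)
    (h7 : σ.reg 7 = p.1) (h8 : σ.reg 8 = p.2)
    (hmin : ∀ q, Leaves P mate p.2 q → d (pairEdge p) ≤ d (pairEdge q)) :
    Wp d W S mergeTop 14 (fun σ' => σ'.reg 6 = σ.reg 6 ∧ IsChainState d (E ++ [p]) K.tail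
      (nextEnds P mate p.1 p.2) (nextMate mate p.1 p.2) (mate p.1) σ') σ := by
  have hc := h.consts
  have hlen := h.chain.length_le
  have h3 : σ.reg 3 = K.length + 1 := h.r3
  rw [List.length_cons] at hlen
  have hloc := h.chain.isLocalStep h.rep hmin
  have hE := h.edges_lt hloc.1
  have hp1 := (h.chain.shortest p (by simp)).1
  have hp2 := (h.chain.shortest p (by simp)).2.1.2.1
  have hm1 := h.mates p.1
  have hm2 := h.mates p.2
  rw [if_pos hp1] at hm1
  rw [if_pos hp2] at hm2
  have e₁ := p.1.2
  have e₂ := p.2.2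
  have e₃ := (mate p.1).2
  have e₄ := (mate p.2).2
  refine Wp.arith (3 * n + E.length) (by simp [ArithOp.eval, hc.r16, h.r4]) (by omega) ?_
  refine Wp.store (3 * n + E.length) p.1 (by simp) (by omega) (by simp [h7]) ?_
  refine Wp.arith (4 * n + E.length) (by simp [ArithOp.eval, hc.r17, h.r4]) (by omega) ?_
  refine Wp.store (4 * n + E.length) p.2 (by simp) (by omega) (by simp [h8]) ?_
  refine Wp.arith (E.length + 1) (by simp [ArithOp.eval, hc.r2, h.r4]) (by omega) ?_
  -- Truncated subtraction of 2 from `K.length + 1` also covers a chain with a single link, which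
  -- becomes empty.
  refine Wp.arith (K.length - 1) (by simp [ArithOp.eval, hc.r19, h3]) (by omega) ?_
  refine Wp.load p.1 (mate p.1) (by simp [h7]) (by omega) ?_ ?_
  · simp only [State.setReg_mem, State.setMem_mem]
    rw [if_neg (by omega), if_neg (by omega), hm1]
  refine Wp.load p.2 (mate p.2) (by simp [h8]) (by omega) ?_ ?_
  · simp only [State.setReg_mem, State.setMem_mem]
    rw [if_neg (by omega), if_neg (by omega), hm2]
  refine Wp.store p.1 n (by simp [h7]) (by omega) (by simp [hc.r0]) ?_
  refine Wp.store p.2 n (by simp [h8]) (by omega) (by simp [hc.r0]) ?_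
  refine Wp.store (mate p.1) (mate p.2) (by simp) (by omega) (by simp) ?_
  refine Wp.store (mate p.2) (mate p.1) (by simp) (by omega) (by simp) ?_
  -- The far end `mate p.1` is an endpoint of the merged fragment; the chain can restart there if it
  -- is empty.
  refine Wp.copy (mate p.1) (by simp) (by simp [hc.r1]) (by omega) ?_
  have hF' := h.rep.append hloc.1
  have hmap : (E ++ [p]).map pairEdge = E.map pairEdge ++ [s(p.1, p.2)] := by simp [pairEdge]
  refine Wp.nil ⟨by simp, ?_⟩
  refine ⟨⟨?_, ?_, ?_, ?_, ?_, ?_, ?_⟩, ?_, ?_, ?_, ?_, ?_, ?_, ?_, by rwa [hmap],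
    by rw [hmap]; exact h.inv.append hloc, h.chain.tail h.rep, ?_⟩
  · simp [hc.r0]
  · simp [hc.r1]
  · simp [hc.r2]
  · simp [hc.r19]
  · simp [hc.r15]
  · simp [hc.r16]
  · simp [hc.r17]
  · simp
  · simp
  · simp
  · simp [h.out]
  · refine h.mates.merge h.rep hloc.1 fun v => ?_
    have := v.2
    simp only [State.setReg_mem, State.setMem_mem, Fin.val_inj]
    rw [if_neg (show ¬ (v : ℕ) = 4 * n + E.length by omega),
      if_neg (show ¬ (v : ℕ) = 3 * n + E.length by omega)]
  · have hl : ArrAt σ.mem n (2 * n) K.tail.reverse := by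
      have := h.links
      rw [List.reverse_cons] at this
      cases K with
      | nil => intro i q hq; simp at hq
      | cons q K =>
        rw [List.reverse_cons] at this
        exact this.of_append.of_append
    refine hl.congr fun i hi => ?_
    rw [List.length_reverse, List.length_tail] at hi
    simp only [State.setReg_mem, State.setMem_mem]
    constructor <;>
    rw [if_neg (by omega), if_neg (by omega), if_neg (by omega), if_neg (by omega),
      if_neg (by omega), if_neg (by omega)]
  · refine h.edges.concat ?_ ?_ fun i hi => ?_
    · simp only [State.setReg_mem, State.setMem_mem]
      rw [if_neg (by omega), if_neg (by omega), if_neg (by omega), if_neg (by omega),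
        if_neg (by omega), if_pos trivial]
    · simp only [State.setReg_mem, State.setMem_mem]
      rw [if_neg (by omega), if_neg (by omega), if_neg (by omega), if_neg (by omega), if_pos trivial]
    · simp only [State.setReg_mem, State.setMem_mem]
      constructor <;>
      rw [if_neg (by omega), if_neg (by omega), if_neg (by omega), if_neg (by omega),
        if_neg (by omega), if_neg (by omega)]
  · obtain ⟨-, -, -, h₄⟩ := h.rep.joins_iff.1 hloc.1
    exact Finset.mem_filter.2 ⟨h.rep.mate_mem _ hp1, fun h => h.2 h.1, fun h => h₄ h.1⟩

/-- The invariant of the main loop, with its variant `m`. -/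
def ChainInv (d : Sym2 (Fin n) → D) (m : ℕ) (σ : State) : Prop :=
  (σ.reg 6 ≠ 0 ∧ ∃ E K P mate r, IsChainState d E K P mate r σ ∧
    m + 3 * E.length + K.length = 4 * n + 1) ∨
  (σ.reg 6 = 0 ∧ ∃ E P mate r, IsChainState d E [] P mate r σ ∧ ∀ q, ¬ Leaves P mate r q)

/-- An extension adds 1 to `3 * E.length + K.length`, and a merge adds at least `3 - 2`. This
quantity is at most `4 * n`, so the variant is positive as long as the loop continues. -/
lemma wp_chainBody (hW : 5 * n + 5 ≤ W) (hS : 5 * n ≤ S) {m : ℕ} (hI : ChainInv d m σ)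
    (hlt : σ.reg 1 < σ.reg 6) :
    Wp d W S chainBody (n * 25 + 31) (fun σ' => ∃ m' < m, ChainInv d m' σ') σ := by
  rcases hI with ⟨-, E, K, P, mate, r, h, hm⟩ | ⟨h6, -⟩
  swap
  · omega
  have hElen := h.length_edges
  have hKlen := h.chain.length_le
  refine Wp.cons (t₂ := n * 25 + 22) (wp_loadTop hW hS h) ?_ (by omega)
  rintro σ₁ ⟨hs₁, hb₁, x, hxP, h10, hxK, hxr⟩
  have h₁ := h.congr hs₁ (by decide)
  refine Wp.load x (mate x) h10 (by omega) (by rw [h₁.mates x, if_pos hxP]) ?_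
  set σ₂ := σ₁.setReg 11 (mate x) with hσ₂
  have hs₂ : SameExcept [11] σ₁ σ₂ := (SameExcept.refl _ _).setReg (by simp)
  have h₂ := h₁.congr hs₂ (by decide)
  refine Wp.cons (t₂ := 18) (wp_scan hW hS h₂.consts h₂.mates (x := x) (old := K.head?)
    (by rw [hs₂.reg _ (by simp), h10]) (by simp [hσ₂])
    (hb₁.congr (by simp [hσ₂]) (by simp [hσ₂]) (by simp [hσ₂]) (by simp [hσ₂]))) ?_ (by omega)
  rintro σ₃ ⟨hs₃, hb₃⟩
  have h₃ := h₂.congr hs₃ (by decide)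
  have hcand : ∀ q, Leaves P mate x q → (q.1, q.2, (q.2 : ℕ)) ∈ candidates P mate x n :=
    fun q hq => ⟨hq, q.2.2, rfl⟩
  refine Wp.cons (t₁ := 17) (t₂ := 1) (R := fun σ' => ∃ m' < m, ChainInv d m' σ') ?_
    (fun σ' h' => Wp.nil h') (by omega)
  -- No exit at all: the last fragment is reached. The top link is still best: it is a shortest exit
  -- from both sides and is added. A strictly shorter exit exists: it becomes the next link.
  cases hb₃ with
  | none h6 ho hC =>
    refine Wp.ifLt (fun _ => Wp.skip ⟨0, by omega, Or.inr ⟨h6, E, P, mate, r, ?_, ?_⟩⟩)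
      (fun hn => ?_)
    · rwa [List.head?_eq_none_iff.1 ho] at h₃
    · intro q hq
      rw [← hxr (List.head?_eq_none_iff.1 ho)] at hq
      have := hcand q hq
      rw [hC] at this
      exact this
    · rw [h6, h₃.consts.r2] at hn
      omega
  | @old p h6 ho h7 h8 hC =>
    refine Wp.ifLt (fun hn => ?_) (fun _ => Wp.ifLt (fun _ => ?_) (fun hn => ?_))
    · rw [h6, h₃.consts.r2] at hn
      omega
    · cases K with
      | nil => simp at ho
      | cons p' K =>
        obtain rfl : p' = p := by simpa using ho
        rw [List.length_cons] at hm hKlen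
        refine (wp_mergeTop hW hS h₃ h7 h8 ?_).mono (by omega) ?_
        · intro q hq
          rw [← hxK p' rfl] at hq
          exact hC _ (hcand q hq)
        · rintro σ' ⟨h6', h'⟩
          have hE' := h'.length_edges
          have hK' := h'.chain.length_le
          rw [List.length_append, List.length_singleton] at hE'
          refine ⟨4 * n + 1 - 3 * (E.length + 1) - K.tail.length, ?_, Or.inl ⟨by omega, _, _, _, _,
            _, h', ?_⟩⟩
          · rw [List.length_tail] at *
            omega
          · rw [List.length_append, List.length_singleton]
            omega
    · rw [h6, h₃.consts.r19] at hn
      omega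
  | @new c h6 hc h7 h8 h9 hC ho =>
    refine Wp.ifLt (fun hn => ?_) (fun _ => Wp.ifLt (fun hn => ?_) (fun _ => ?_))
    · rw [h6, h₃.consts.r2] at hn
      omega
    · rw [h6, h₃.consts.r19] at hn
      omega
    · have hchain : IsNeighborChain d P mate ((c.1, c.2.1) :: K) :=
        h.chain.cons h.rep hxP hxK hc.1 (fun q hq => hC _ (hcand q hq)) ho
      have hKlen' := hchain.length_le
      rw [List.length_cons] at hKlen'
      refine (wp_pushLink hW hS h₃ (p := (c.1, c.2.1)) h7 h8 hchain).mono (by omega) ?_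
      rintro σ' ⟨h6', h'⟩
      refine ⟨m - 1, by omega, Or.inl ⟨by omega, _, _, _, _, _, h', ?_⟩⟩
      rw [List.length_cons]
      omega

end Loop

/-! ### Selection sort of the included edges. -/

section Output

variable {n : ℕ} {D : Type*} [LinearOrder D] {d : Sym2 (Fin n) → D} {W S : ℕ} {σ σ' : State}
  {e : ℕ → Fin n × Fin n} {k : ℕ} {J : Finset ℕ} {O : List (Fin n × Fin n)} {r s : Fin n}

/-- The representation of a pair of sites on the output tape. -/
def pairVal (p : Fin n × Fin n) : ℕ × ℕ := (p.1, p.2)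

/-- The state of the machine when of the edges `e 0, ..., e (k - 1)` those with index in `J` remain
to be written, and those in `O` have been written; `s` is the mate of `r`. -/
structure IsSortState (d : Sym2 (Fin n) → D) (e : ℕ → Fin n × Fin n) (k : ℕ) (r s : Fin n)
    (J : Finset ℕ) (O : List (Fin n × Fin n)) (σ : State) : Prop where
  consts : HasConsts n σ
  r4 : σ.reg 4 = k
  r5 : σ.reg 5 = r
  length_le : k ≤ n
  fst : ∀ j < k, σ.mem (3 * n + j) = if j ∈ J then ((e j).1 : ℕ) else n
  snd : ∀ j < k, σ.mem (4 * n + j) = (e j).2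
  mate : σ.mem r = s
  out : σ.out = O.map pairVal
  subset : J ⊆ Finset.range k
  perm : (O : Multiset (Fin n × Fin n)) + J.val.map e = (Finset.range k).val.map e
  sorted : O.Pairwise fun p q => d (pairEdge p) ≤ d (pairEdge q)
  le : ∀ o ∈ O, ∀ j ∈ J, d (pairEdge o) ≤ d (pairEdge (e j))

lemma IsSortState.congr {l : List ℕ} (h : IsSortState d e k r s J O σ)
    (hs : SameExcept l σ σ') (hl : ∀ i ∈ [0, 1, 2, 4, 5, 15, 16, 17, 19], i ∉ l) :
    IsSortState d e k r s J O σ' := by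
  refine ⟨h.consts.congr hs fun i hi => hl i ((by decide :
    [0, 1, 2, 19, 15, 16, 17] ⊆ [0, 1, 2, 4, 5, 15, 16, 17, 19]) hi), ?_, ?_, h.length_le, ?_, ?_,
    ?_, ?_, h.subset, h.perm, h.sorted, h.le⟩
  · rw [hs.reg _ (hl _ (by simp)), h.r4]
  · rw [hs.reg _ (hl _ (by simp)), h.r5]
  · rw [hs.mem]; exact h.fst
  · rw [hs.mem]; exact h.snd
  · rw [hs.mem]; exact h.mate
  · rw [hs.out]; exact h.out

/-- Compare the edge with the index in register `12`, if it remains to be written. -/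
def selectBody : Program := block [.arith .add 18 16 12, .load 13 18,
  .ifLt 13 0 (block [.arith .add 18 17 12, .load 14 18, consider 13 14 12]) .skip,
  .arith .add 12 12 2]

/-- Write a shortest remaining edge, and mark it as written. -/
def emitNext : Program := block [.const 6 0, .const 12 0, .whileLt 12 4 selectBody, .emit 7 8,
  .arith .add 18 16 9, .store 18 0, .arith .add 20 20 2]

/-- The candidates with index less than `j`. -/
def remaining (e : ℕ → Fin n × Fin n) (J : Finset ℕ) (j : ℕ) : Set (Fin n × Fin n × ℕ) :=
  {c | ∃ i ∈ J, i < j ∧ c = ((e i).1, (e i).2, i)}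

lemma remaining_succ_of_mem {j : ℕ} (h : j ∈ J) :
    remaining e J (j + 1) = insert ((e j).1, (e j).2, j) (remaining e J j) := by
  ext c
  simp only [remaining, Set.mem_ofPred_eq, Set.mem_insert_iff, Nat.lt_succ_iff_lt_or_eq]
  constructor
  · rintro ⟨i, hi, h' | rfl, rfl⟩
    · exact Or.inr ⟨i, hi, h', rfl⟩
    · exact Or.inl rfl
  · rintro (rfl | ⟨i, hi, h', rfl⟩)
    · exact ⟨j, h, Or.inr rfl, rfl⟩
    · exact ⟨i, hi, Or.inl h', rfl⟩

lemma remaining_succ_of_notMem {j : ℕ} (h : j ∉ J) :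
    remaining e J (j + 1) = remaining e J j := by
  ext c
  simp only [remaining, Set.mem_ofPred_eq, Nat.lt_succ_iff_lt_or_eq]
  constructor
  · rintro ⟨i, hi, h' | rfl, rfl⟩
    · exact ⟨i, hi, h', rfl⟩
    · exact absurd hi h
  · rintro ⟨i, hi, h', rfl⟩
    exact ⟨i, hi, Or.inl h', rfl⟩

lemma wp_selectBody (hW : 5 * n + 5 ≤ W) (hS : 5 * n ≤ S) (h : IsSortState d e k r s J O σ)
    {j : ℕ} (hj : j < k) (h12 : σ.reg 12 = j) (hb : IsBest d none (remaining e J j) σ) :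
    Wp d W S selectBody 15 (fun σ' => SameExcept [6, 7, 8, 9, 12, 13, 14, 18] σ σ' ∧
      σ'.reg 12 = j + 1 ∧ IsBest d none (remaining e J (j + 1)) σ') σ := by
  have hc := h.consts
  have hk := h.length_le
  refine Wp.arith (3 * n + j) (by simp [ArithOp.eval, hc.r16, h12]) (by omega) ?_
  refine Wp.load (3 * n + j) _ (by simp) (by omega) (h.fst j hj) ?_
  set σ₁ := (σ.setReg 18 (3 * n + j)).setReg 13 (if j ∈ J then ((e j).1 : ℕ) else n) with hσ₁
  have hs₁ : SameExcept [6, 7, 8, 9, 13, 14, 18] σ σ₁ :=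
    ((SameExcept.refl _ _).setReg (by simp)).setReg (by simp)
  have hb₁ : IsBest d none (remaining e J j) σ₁ :=
    hb.congr (by simp [hσ₁]) (by simp [hσ₁]) (by simp [hσ₁]) (by simp [hσ₁])
  refine Wp.cons (t₁ := 11) (t₂ := 2) (R := fun σ' =>
    SameExcept [6, 7, 8, 9, 13, 14, 18] σ σ' ∧ IsBest d none (remaining e J (j + 1)) σ') ?_ ?_
    (by omega)
  · refine Wp.ifLt (fun hlt => ?_) (fun hlt => Wp.skip ⟨hs₁, ?_⟩)
    · have hjJ : j ∈ J := by
        by_contra hjJ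
        simp [hσ₁, hjJ, hc.r0] at hlt
      refine Wp.arith (4 * n + j) (by simp [hσ₁, ArithOp.eval, hc.r17, h12]) (by omega) ?_
      refine Wp.load (4 * n + j) (e j).2 (by simp) (by omega) (by simpa [hσ₁] using h.snd j hj) ?_
      refine Wp.cons (t₂ := 1) (wp_consider (w := j) (u := (e j).1) (v := (e j).2) (old := none)
        (C := remaining e J j) (by omega) (by omega) (by omega) ?_ ?_ ?_ ?_ ?_ ?_ (by simp)
        (by simp) (by simp)) ?_ (by omega)
      · exact hb₁.congr (by simp) (by simp) (by simp) (by simp)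
      · simp [hσ₁, hc.r1]
      · simp [hσ₁, hc.r2]
      · simp [hσ₁, hjJ]
      · simp
      · simp [hσ₁, h12]
      · rintro σ₂ ⟨hs₂, hb₂⟩
        refine Wp.nil ⟨?_, by rwa [remaining_succ_of_mem hjJ]⟩
        exact ((hs₁.setReg (x := 18) (by simp)).setReg (x := 14) (by simp)).trans hs₂
          (List.Subset.refl _) (by simp)
    · have hjJ : j ∉ J := by
        intro hjJ
        simp [hσ₁, hjJ, hc.r0] at hlt
      rwa [remaining_succ_of_notMem hjJ]
  · rintro σ₂ ⟨hs₂, hb₂⟩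
    refine Wp.arith (j + 1) ?_ (by omega) (Wp.nil ⟨?_, by simp, ?_⟩)
    · rw [hs₂.reg _ (by simp), hs₂.reg _ (by simp), h12, hc.r2]
      rfl
    · exact (hs₂.trans (SameExcept.refl [] _) (l := [6, 7, 8, 9, 12, 13, 14, 18]) (by simp)
        (by simp)).setReg (by simp)
    · exact hb₂.congr (by simp) (by simp) (by simp) (by simp)

lemma wp_emitNext (hW : 5 * n + 5 ≤ W) (hS : 5 * n ≤ S) (h : IsSortState d e k r s J O σ)
    {i : ℕ} (hi : i < k) (h20 : σ.reg 20 = i) (hJ : J.card + i = k) :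
    Wp d W S emitNext (n * 16 + 8) (fun σ' => σ'.reg 20 = i + 1 ∧
      ∃ J O, IsSortState d e k r s J O σ' ∧ J.card + (i + 1) = k) σ := by
  have hk := h.length_le
  refine Wp.const (by omega) (Wp.const (by omega) ?_)
  refine Wp.cons (t₁ := k * 16 + 1) (t₂ := 5) (Wp.forLt (c := 15) (b := k) (Inv := fun j σ' =>
    SameExcept [6, 7, 8, 9, 12, 13, 14, 18] σ σ' ∧ σ'.reg 12 = j ∧ j ≤ k ∧
      IsBest d none (remaining e J j) σ') ?_ ?_ ?_) ?_ (by omega)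
  · rintro j σ' ⟨hs, h12, hj, -⟩
    exact ⟨h12, by rw [hs.reg _ (by simp), h.r4], hj⟩
  · rintro j σ' hj ⟨hs, h12, -, hb⟩
    refine (wp_selectBody hW hS (h.congr hs (by decide)) hj h12 hb).mono le_rfl ?_
    rintro σ'' ⟨hs', h12', hb'⟩
    exact ⟨hs.trans hs' (List.Subset.refl _) (List.Subset.refl _), h12', hj, hb'⟩
  · refine ⟨((SameExcept.refl _ _).setReg (by simp)).setReg (by simp), by simp, by omega, ?_⟩
    exact .none (by simp) rfl (by ext; simp [remaining])
  · rintro σ₁ ⟨hs, -, -, hb⟩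
    have h₁ := h.congr hs (by decide)
    have hc := h₁.consts
    have h20' : σ₁.reg 20 = i := by rw [hs.reg _ (by simp), h20]
    have hmem : ∀ j ∈ J, ((e j).1, (e j).2, j) ∈ remaining e J k := fun j hj =>
      ⟨j, hj, Finset.mem_range.1 (h.subset hj), rfl⟩
    cases hb with
    | none _ _ hC =>
      obtain ⟨j, hj⟩ := Finset.card_pos.1 (show 0 < J.card by omega)
      have := hmem j hj
      rw [hC] at this
      exact absurd this (Set.notMem_empty _)
    | old _ ho => simp at ho
    | @new c h6 hc' h7 h8 h9 hC _ =>
      obtain ⟨j, hj, hjk, rfl⟩ := hc'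
      have hmin : ∀ j' ∈ J, d (pairEdge (e j)) ≤ d (pairEdge (e j')) :=
        fun j' hj' => hC _ (hmem j' hj')
      refine Wp.emit (e j).1 (e j).2 h7 h8 ?_
      refine Wp.arith (3 * n + j) (by simp [ArithOp.eval, hc.r16, h9]) (by omega) ?_
      -- Sites are less than `n`, so the value `n` marks the edge as written.
      refine Wp.store (3 * n + j) n (by simp) (by omega) (by simp [hc.r0]) ?_
      refine Wp.arith (i + 1) (by simp [ArithOp.eval, hc.r2, h20']) (by omega) ?_
      refine Wp.nil ⟨by simp, J.erase j, O ++ [e j], ?_, by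
        rw [Finset.card_erase_of_mem hj]
        have := Finset.card_pos.2 ⟨j, hj⟩
        omega⟩
      refine ⟨⟨?_, ?_, ?_, ?_, ?_, ?_, ?_⟩, ?_, ?_, hk, ?_, ?_, ?_, ?_, ?_, ?_, ?_, ?_⟩
      · simp [hc.r0]
      · simp [hc.r1]
      · simp [hc.r2]
      · simp [hc.r19]
      · simp [hc.r15]
      · simp [hc.r16]
      · simp [hc.r17]
      · simp [h₁.r4]
      · simp [h₁.r5]
      · intro j' hj'
        simp only [State.setReg_mem, State.setMem_mem, State.append_mem, Finset.mem_erase]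
        by_cases hjj : j' = j
        · simp [hjj]
        · rw [if_neg (by omega), h₁.fst j' hj']
          simp [hjj]
      · intro j' hj'
        simp only [State.setReg_mem, State.setMem_mem, State.append_mem]
        rw [if_neg (by omega), h₁.snd j' hj']
      · simp only [State.setReg_mem, State.setMem_mem, State.append_mem]
        rw [if_neg (by omega), h₁.mate]
      · simp [h₁.out, pairVal]
      · exact (Finset.erase_subset _ _).trans h.subset
      · rw [← h.perm, ← Multiset.coe_add, add_assoc, Finset.erase_val]
        congr 1
        rw [← Multiset.cons_erase (show j ∈ J.val from hj), Multiset.map_cons, Multiset.erase_cons_head]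
        rfl
      · refine List.pairwise_append.2 ⟨h.sorted, List.pairwise_singleton _ _, fun o ho q hq => ?_⟩
        rw [List.mem_singleton.1 hq]
        exact h.le o ho j hj
      · intro o ho j' hj'
        have hj'' := Finset.mem_of_mem_erase hj'
        rcases List.mem_append.1 ho with ho | ho
        · exact h.le o ho j' hj''
        · rw [List.mem_singleton.1 ho]
          exact hmin j' hj''

/-- Write the included edges in sorted order. -/
def emitEdges : Program := block [.const 20 0, .whileLt 20 4 emitNext]

lemma wp_emitEdges (hW : 5 * n + 5 ≤ W) (hS : 5 * n ≤ S)
    (h : IsSortState d e k r s (Finset.range k) [] σ) :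
    Wp d W S emitEdges (n * (n * 16 + 9) + 3)
      (fun σ' => ∃ O, IsSortState d e k r s ∅ O σ') σ := by
  have hk := h.length_le
  refine Wp.const (by omega) ?_
  refine Wp.cons (t₁ := k * (n * 16 + 9) + 1) (t₂ := 1) (Wp.forLt (c := n * 16 + 8) (b := k)
    (Inv := fun i σ' => σ'.reg 20 = i ∧
      ∃ J O, IsSortState d e k r s J O σ' ∧ J.card + i = k) ?_ ?_ ?_) ?_ ?_
  · rintro i σ' ⟨h20, J, O, h', hJ⟩
    exact ⟨h20, h'.r4, by omega⟩
  · rintro i σ' hi ⟨h20, J, O, h', hJ⟩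
    exact wp_emitNext hW hS h' hi h20 hJ
  · exact ⟨by simp, _, _, h.congr ((SameExcept.refl [20] _).setReg (by simp)) (by decide),
      by simp⟩
  · rintro σ' ⟨-, J, O, h', hJ⟩
    obtain rfl : J = ∅ := Finset.card_eq_zero.1 (by omega)
    exact Wp.nil ⟨O, h'⟩
  · have := Nat.mul_le_mul_right (n * 16 + 9) hk
    omega

/-- The default `(r, r)` is irrelevant, because only indices below `E.length` matter to the sorting
phase. -/
lemma IsChainState.isSortState {E K : List (Fin n × Fin n)} {P : Finset (Fin n)}
    {mate : Fin n → Fin n} (h : IsChainState d E K P mate r σ) :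
    IsSortState d (fun j => E.getD j (r, r)) E.length r (mate r) (Finset.range E.length) [] σ := by
  have hE : ∀ j < E.length, E[j]? = some (E.getD j (r, r)) := by
    intro j hj
    simp [List.getD, hj]
  refine ⟨h.consts, h.r4, h.r5, h.length_edges, ?_, ?_, ?_, by simp [h.out], subset_rfl, by simp,
    List.Pairwise.nil, by simp⟩
  · intro j hj
    rw [if_pos (Finset.mem_range.2 hj)]
    exact (h.edges j _ (hE j hj)).1
  · intro j hj
    exact (h.edges j _ (hE j hj)).2
  · rw [h.mates r, if_pos h.mem]

lemma range_map_getD {α : Type*} (l : List α) (a : α) :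
    (Finset.range l.length).val.map (fun j => l.getD j a) = (l : Multiset α) := by
  rw [Finset.range_val, ← Multiset.coe_range, Multiset.map_coe]
  congr 1
  refine List.ext_getElem (by simp) fun i h₁ h₂ => ?_
  simp [List.getD, h₂]

end Output

/-! ### The whole program and its bounds. -/

section Main

variable {n : ℕ} {D : Type*} [LinearOrder D] {d : Sym2 (Fin n) → D} {W S : ℕ} {σ σ' : State}

/-- Make every site a trivial fragment. -/
def initSites : Program := block [.const 2 1, .const 19 2, .arith .add 15 0 0,
  .arith .add 16 15 0, .arith .add 17 16 0, .const 12 0,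
  .whileLt 12 0 (block [.store 12 12, .arith .add 12 12 2]), .const 6 1]

/-- The implementation of the multiple-fragment heuristic by nearest-neighbor chains. -/
def heuristic : Program := .ifLt 1 0 (block [initSites, .whileLt 1 6 chainBody, emitEdges,
  .ifLt 19 0 (block [.load 11 5, .emit 5 11]) .skip]) .skip

lemma wp_initSites (hW : 5 * n + 5 ≤ W) (hS : 5 * n ≤ S) (hn : 0 < n) :
    Wp d W S initSites (n * 4 + 9) (ChainInv d (4 * n + 1)) (State.init n) := by
  refine Wp.const (by omega) (Wp.const (by omega) ?_)
  refine Wp.arith (2 * n) (by simp [ArithOp.eval, State.init]; omega) (by omega) ?_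
  refine Wp.arith (3 * n) (by simp [ArithOp.eval, State.init]; omega) (by omega) ?_
  refine Wp.arith (4 * n) (by simp [ArithOp.eval, State.init]; omega) (by omega) ?_
  refine Wp.const (by omega) ?_
  refine Wp.cons (t₁ := n * 4 + 1) (t₂ := 2) (Wp.forLt (c := 3) (b := n)
    (Inv := fun j σ => HasConsts n σ ∧ σ.reg 3 = 0 ∧ σ.reg 4 = 0 ∧ σ.reg 5 = 0 ∧ σ.out = [] ∧
      σ.reg 12 = j ∧ j ≤ n ∧ ∀ i < j, σ.mem i = i) ?_ ?_ ?_) ?_ le_rfl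
  · rintro j σ ⟨hc, -, -, -, -, h12, hj, -⟩
    exact ⟨h12, hc.r0, hj⟩
  · rintro j σ hj ⟨hc, h3, h4, h5, ho, h12, -, hm⟩
    refine Wp.store j j h12 (by omega) h12 ?_
    refine Wp.arith (j + 1) (by simp [ArithOp.eval, h12, hc.r2]) (by omega) (Wp.nil ?_)
    refine ⟨⟨?_, ?_, ?_, ?_, ?_, ?_, ?_⟩, ?_, ?_, ?_, ?_, ?_, hj, fun i hi => ?_⟩
    · simp [hc.r0]
    · simp [hc.r1]
    · simp [hc.r2]
    · simp [hc.r19]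
    · simp [hc.r15]
    · simp [hc.r16]
    · simp [hc.r17]
    · simp [h3]
    · simp [h4]
    · simp [h5]
    · simp [ho]
    · simp
    · simp only [State.setReg_mem, State.setMem_mem]
      split_ifs with hij
      · exact hij.symm
      · exact hm i (by omega)
  · refine ⟨⟨?_, ?_, ?_, ?_, ?_, ?_, ?_⟩, ?_, ?_, ?_, ?_, ?_, by omega, by simp⟩ <;>
      simp [State.init]
  · rintro σ ⟨hc, h3, h4, h5, ho, -, -, hm⟩
    -- The chain is empty, and site `0` serves as the first endpoint; this needs `0 < n`.
    refine Wp.const (by omega) (Wp.nil (Or.inl ⟨by simp, [], [], Finset.univ, id, ⟨0, hn⟩, ?_,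
      by simp⟩))
    have hs : SameExcept [6] σ (σ.setReg 6 1) := (SameExcept.refl _ _).setReg (by simp)
    refine ⟨hc.congr hs (by decide), ?_, ?_, ?_, ?_, ?_, ?_, ?_, Represents.nil, LocalInv.nil,
      .nil, Finset.mem_univ _⟩
    · simp [h3]
    · simp [h4]
    · simp [h5]
    · simp [ho]
    · intro v
      simp [hm v v.2]
    · intro i p hp
      simp at hp
    · intro i p hp
      simp at hp

lemma lists_map_pairVal (O : List (Fin n × Fin n)) :
    Lists (O.map pairVal) (O.map pairEdge) := by
  induction O with
  | nil => exact .nil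
  | cons p O ih => exact .cons ⟨p.1, p.2, rfl, rfl⟩ ih

/-- The final edges of the chain algorithm, in sorted order, are found by the heuristic. -/
lemma LocalInv.isEdgeSequence {F G : List (Sym2 (Fin n))} (h : LocalInv d F)
    (hF : ∀ e, ¬ Joins F e) (hG : G.Perm F) (hs : G.Pairwise fun e f => d e ≤ d f) :
    IsEdgeSequence d G := by
  refine isEdgeSequence_of_blocked (hG.nodup_iff.2 h.nodup) (fun e he => ?_) hs fun g hg hd hj => ?_
  · exact (h.joins_filter e (hG.subset he)).anti (hG.filter _).subset
  · refine ((h.blocked g (fun hm => hg (hG.mem_iff.2 hm)) hd).resolve_left (hF g)) ?_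
    exact hj.anti (hG.filter _).symm.subset

/-- At most `4 * n + 1` rounds of the chain cost `n * 25 + 31` steps and one test each; writing at
most `n` edges takes one pass over the remaining ones for each. -/
lemma wp_heuristic (hW : 5 * n + 5 ≤ W) (hS : 5 * n ≤ S) :
    Wp d W S heuristic ((4 * n + 1) * (n * 25 + 32) + n * (n * 16 + 9) + n * 4 + 20)
      (fun σ => ∃ T, IsTour d T ∧ Lists σ.out T) (State.init n) := by
  refine Wp.ifLt (fun hn => ?_) (fun hn => ?_)
  · have hn : 0 < n := by simpa [State.init] using hn
    refine Wp.cons (t₁ := n * 4 + 9)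
      (t₂ := (4 * n + 1) * (n * 25 + 32) + n * (n * 16 + 9) + 10)
      (wp_initSites hW hS hn) (fun σ₁ h₁ => ?_) (by omega)
    refine Wp.cons (t₁ := (4 * n + 1) * (n * 25 + 32) + 1) (t₂ := n * (n * 16 + 9) + 9)
      (Wp.whileLt (fun m σ hI hlt => wp_chainBody hW hS hI hlt) h₁) ?_ (by omega)
    rintro σ₂ ⟨⟨m, hI⟩, hlt⟩
    obtain ⟨E, P, mate, r, h₂, hfin⟩ : ∃ E P mate r, IsChainState d E [] P mate r σ₂ ∧
        ∀ q, ¬ Leaves P mate r q := by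
      rcases hI with ⟨h6, E, K, P, mate, r, h, -⟩ | ⟨-, h⟩
      · rw [h.consts.r1] at hlt
        omega
      · exact h
    refine Wp.cons (t₂ := 5) (wp_emitEdges hW hS h₂.isSortState) ?_ (by omega)
    rintro σ₃ ⟨O, h₃⟩
    have hperm : O.Perm E := by
      have := h₃.perm
      rw [range_map_getD] at this
      simpa using this
    have hseq : IsEdgeSequence d (O.map pairEdge) :=
      h₂.inv.isEdgeSequence (h₂.rep.not_joins h₂.mem hfin) (hperm.map _)
        (by rw [List.pairwise_map]; exact h₃.sorted)
    have hend : ∀ v ∈ P, IsEndpoint (O.map pairEdge) v := fun v hv =>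
      ((h₂.rep.mem_iff v).1 hv).anti (hperm.map _).subset
    refine Wp.cons (t₁ := 4) (t₂ := 1) ?_ (fun σ' h' => Wp.nil h') (by omega)
    refine Wp.ifLt (fun h2 => ?_) (fun h2 => Wp.skip ?_)
    -- For `2 < n` the closing edge runs between the starting endpoint `r` and its mate, the ends of
    -- the last fragment.
    · rw [h₃.consts.r0, h₃.consts.r19] at h2
      refine Wp.load r (mate r) h₃.r5 (by omega) h₃.mate ?_
      refine Wp.emit r (mate r) (by simp [h₃.r5]) (by simp) (Wp.nil ?_)
      refine ⟨(O ++ [(r, mate r)]).map pairEdge, ⟨O.map pairEdge, hseq, fun h => by omega,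
        fun _ => ⟨r, mate r, h₂.rep.mate_ne h₂.mem hfin h2.le, hend r h₂.mem,
          hend _ (h₂.rep.mate_mem r h₂.mem), by simp [pairEdge]⟩⟩, ?_⟩
      have : (((σ₃.setReg 11 (mate r)).append r (mate r)).out) =
          (O ++ [(r, mate r)]).map pairVal := by
        simp [h₃.out, pairVal]
      rw [this]
      exact lists_map_pairVal _
    · rw [h₃.consts.r0, h₃.consts.r19] at h2
      refine ⟨O.map pairEdge, ⟨_, hseq, fun _ => rfl, fun h => by omega⟩, ?_⟩
      rw [h₃.out]
      exact lists_map_pairVal _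
  · have hn : n = 0 := by simpa [State.init] using hn
    subst hn
    refine Wp.skip ⟨[], ⟨[], ?_, fun _ => rfl, fun h => by omega⟩, .nil⟩
    refine isEdgeSequence_of_blocked List.nodup_nil (by simp) .nil fun g => ?_
    induction g with
    | h u v => exact u.elim0

/-- A bound for the running time of the program `heuristic`. -/
def timeBound (n : ℕ) : ℕ := 200 * (n + 1) ^ 2

/-- The integers and addresses need only the word bound `5 * n + 5`, and `(n + 2) ^ 4` exceeds it
for every `n`, including `0`. -/
lemma findsTour_heuristic (d : Sym2 (Fin n) → D) :
    FindsTour heuristic d ((n + 2) ^ 4) (5 * n) (timeBound n) := by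
  obtain ⟨t, ht, σ, he, hT⟩ := wp_heuristic (d := d) (W := (n + 2) ^ 4) (S := 5 * n)
    (by ring_nf; nlinarith [Nat.zero_le (n ^ 2), Nat.zero_le (n ^ 3), Nat.zero_le (n ^ 4)]) le_rfl
  refine ⟨t, ht.trans ?_, σ, he, hT⟩
  rw [timeBound]
  ring_nf
  nlinarith [Nat.zero_le (n ^ 2)]

lemma timeBound_isBigO : (fun n => (timeBound n : ℝ)) =O[atTop] fun n : ℕ => (n : ℝ) ^ 2 := by
  -- For `n ≥ 1` we have `n + 1 ≤ 2 * n`, hence the factor `200 * 4`.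
  refine IsBigO.of_bound 800 ?_
  filter_upwards [eventually_ge_atTop 1] with n hn
  have hn' : (1 : ℝ) ≤ n := by exact_mod_cast hn
  rw [Real.norm_of_nonneg (by positivity), Real.norm_of_nonneg (by positivity), timeBound]
  push_cast
  nlinarith

lemma sq_isBigO_sq_mul_log_sq :
    (fun n : ℕ => (n : ℝ) ^ 2) =O[atTop] fun n : ℕ => (n : ℝ) ^ 2 * Real.log n ^ 2 := by
  refine IsBigO.of_bound 1 ?_
  -- From `3 > e` on, the logarithm is at least `1`.
  filter_upwards [eventually_ge_atTop 3] with n hn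
  have hn' : (3 : ℝ) ≤ n := by exact_mod_cast hn
  have hlog : 1 ≤ Real.log n := by
    rw [Real.le_log_iff_exp_le (by linarith)]
    linarith [Real.exp_one_lt_d9]
  rw [Real.norm_of_nonneg (by positivity), Real.norm_of_nonneg (by positivity), one_mul]
  exact le_mul_of_one_le_right (by positivity) (one_le_pow₀ hlog)

end Main

end MultipleFragment

theorem mainTheorem4 :
    -- the heuristic, fragment clustering and endpoint closest pairs give the same edge sequences
    (∀ (n : ℕ) (D : Type*) [LinearOrder D] (d : Sym2 (Fin n) → D) (F : List (Sym2 (Fin n))),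
      (MultipleFragment.IsClusteringSequence d F ↔ MultipleFragment.IsEdgeSequence d F) ∧
      (MultipleFragment.IsEndpointSequence d F ↔ MultipleFragment.IsEdgeSequence d F)) ∧
    -- time `O(n ^ 2)`
    (∃ (p : MultipleFragment.Program) (k : ℕ) (S T : ℕ → ℕ),
      ((fun n => (T n : ℝ)) =O[atTop] fun n : ℕ => (n : ℝ) ^ 2) ∧
      ∀ (n : ℕ) (D : Type*) [LinearOrder D] (d : Sym2 (Fin n) → D),
        MultipleFragment.FindsTour p d ((n + 2) ^ k) (S n) (T n)) ∧
    -- time `O(n ^ 2 * log ^ 2 n)` and space `O(n)`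
    (∃ (p : MultipleFragment.Program) (k : ℕ) (S T : ℕ → ℕ),
      ((fun n => (T n : ℝ)) =O[atTop] fun n : ℕ => (n : ℝ) ^ 2 * Real.log n ^ 2) ∧
      ((fun n => (S n : ℝ)) =O[atTop] fun n : ℕ => (n : ℝ)) ∧
      ∀ (n : ℕ) (D : Type*) [LinearOrder D] (d : Sym2 (Fin n) → D),
        MultipleFragment.FindsTour p d ((n + 2) ^ k) (S n) (T n)) := by
  refine ⟨fun n D _ d F => ⟨?_, ?_⟩, ?_, ?_⟩
  · rw [MultipleFragment.isClusteringSequence_iff_greedyRun,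
      MultipleFragment.isEdgeSequence_iff_greedyRun]
  · rw [MultipleFragment.isEndpointSequence_iff_greedyRun,
      MultipleFragment.isEdgeSequence_iff_greedyRun]
  · exact ⟨MultipleFragment.heuristic, 4, fun n => 5 * n, MultipleFragment.timeBound,
      MultipleFragment.timeBound_isBigO, fun n D _ d => MultipleFragment.findsTour_heuristic d⟩
  -- The nearest-neighbor chain algorithm also works in linear space.
  · refine ⟨MultipleFragment.heuristic, 4, fun n => 5 * n, MultipleFragment.timeBound,
      MultipleFragment.timeBound_isBigO.trans MultipleFragment.sq_isBigO_sq_mul_log_sq, ?_,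
      fun n D _ d => MultipleFragment.findsTour_heuristic d⟩
    simp only [Nat.cast_mul]
    exact (isBigO_refl _ _).const_mul_left _
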